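/- Let $H_d, H_1,\dots,H_m$ be traceless Hermitian $n\times n$ matrices and consider the control problem $$ i\,\dot U(t) = \Big(H_d+\sum_{j=1}^m f_j(t)H_j\Big)U(t),\qquad U(0)=\mathbb 1, $$ where the controls $f_j$ are arbitrary real-valued integrable functions (with no bound on their size). Let $\mathfrak g$ be the real Lie algebra generated by $iH_d,iH_1,\dots,iH_m$, let $\mathfrak k\subseteq\mathfrak g$ be the real Lie algebra generated by $iH_1,\dots,iH_m$, and let $G, K\subseteq \mathrm{SU}(n)$ be the subgroups generated by $\exp(\mathfrak g)$ and $\exp(\mathfrak k)$ (the dynamical group and the control group). Assume that $K$ is a closed subset of $\mathrm{SU}(n)$. Let $G/K$ be the space of right cosets $[g]=Kg$, $g\in G$, with the $G$-invariant Riemannian metric induced by the inner product $\langle X,Y\rangle=-2n\,\mathrm{Tr}(XY)$ on $\mathfrak g$: with $\mathfrak p=\mathfrak k^\perp\subseteq\mathfrak g$ and $P:\mathfrak g\to\mathfrak p$ the orthogonal projection, the length of the curve $t\mapsto[\gamma(t)]$ is $\int_0^1\|P(\dot\gamma(t)\gamma(t)^{-1})\|\,dt$ for every $C^1$ curve $\gamma:[0,1]\to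 G$. Let $d(x,y)$ be the infimum of the lengths of the $C^1$ curves in $G/K$ joining $x$ and $y$, and let $\mathrm{diam}(G/K)=\sup_{x,y}d(x,y)\in[0,\infty]$. Let $T_{\mathrm{QSL}}\in[0,\infty]$ be the minimal time in which all unitaries of $G$ can be reached, that is, the infimum of all $T\ge 0$ such that for every $V\in G$ there are controls and a time $t\le T$ with $U(t)=V$ (with $T_{\mathrm{QSL}}=\infty$ if there is no such $T$). Then $$ T_{\mathrm{QSL}}\;\ge\;\frac{\mathrm{diam}(G/K)}{\sqrt{2n\,\mathrm{Tr}(H_d^2)}}, $$ where $0/0$ is read as $0$ (this concerns only $H_d=0$, where $G=K$). -/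

import Mathlib

open scoped ENNReal Matrix

attribute [local instance] LieRing.ofAssociativeRing

/-- The data of a quantum control problem `H = H_d + ∑ j, f_j(t) H_j` on an `n`-dimensional Hilbert
space: the drift and the control Hamiltonians are traceless Hermitian matrices. -/
structure ControlSystem (n m : ℕ) where
  /-- the drift Hamiltonian `H_d` -/
  drift : Matrix (Fin n) (Fin n) ℂ
  /-- the control Hamiltonians `H_j` -/
  ctrl : Fin m → Matrix (Fin n) (Fin n) ℂ
  drift_isHermitian : drift.IsHermitian
  drift_trace : drift.trace = 0
  ctrl_isHermitian : ∀ j, (ctrl j).IsHermitian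
  ctrl_trace : ∀ j, (ctrl j).trace = 0

namespace ControlSystem

/-! ### The inner product -/

/-- The real bilinear form `⟨X, Y⟩ = -2n Tr(XY)`. (On skew-Hermitian matrices the trace `Tr(XY)` is
real, so that taking the real part does not change it there.) -/
noncomputable def form (n : ℕ) : LinearMap.BilinForm ℝ (Matrix (Fin n) (Fin n) ℂ) :=
  LinearMap.mk₂ ℝ (fun X Y => -(2 * (n : ℝ)) * ((X * Y).trace).re)
    (fun X X' Y => by simp [add_mul, mul_add])
    (fun c X Y => by simp; ring)
    (fun X Y Y' => by simp [mul_add])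
    (fun c X Y => by simp; ring)

theorem form_apply (n : ℕ) (X Y : Matrix (Fin n) (Fin n) ℂ) :
    form n X Y = -(2 * (n : ℝ)) * ((X * Y).trace).re := rfl

theorem form_isRefl (n : ℕ) : (form n).IsRefl := by
  intro X Y h
  rw [form_apply] at h ⊢
  rwa [Matrix.trace_mul_comm]

/-- The form is definite on skew-Hermitian matrices. -/
theorem eq_zero_of_form_self {n : ℕ} {X : Matrix (Fin n) (Fin n) ℂ} (hX : Xᴴ = -X)
    (h : form n X X = 0) : X = 0 := by
  rcases Nat.eq_zero_or_pos n with rfl | hn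
  · exact Subsingleton.elim _ _
  · rw [form_apply] at h
    have hn' : (0 : ℝ) < n := by exact_mod_cast hn
    have h1 : ((X * X).trace).re = 0 := by
      rcases mul_eq_zero.mp h with h | h
      · linarith
      · exact h
    have h2 : ((Xᴴ * X).trace).re = 0 := by simp [hX, h1]
    have h3 : ∑ j, ∑ i, Complex.normSq (X i j) = 0 := by
      rw [← h2]
      simp [Matrix.trace, Matrix.mul_apply, Complex.normSq_apply]
    ext i j
    have h4 := (Finset.sum_eq_zero_iff_of_nonneg (fun j _ =>
      Finset.sum_nonneg fun i _ => Complex.normSq_nonneg (X i j))).mp h3 j (Finset.mem_univ j)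
    have h5 := (Finset.sum_eq_zero_iff_of_nonneg
      (fun i _ => Complex.normSq_nonneg (X i j))).mp h4 i (Finset.mem_univ i)
    simpa using h5

variable {n m : ℕ} (S : ControlSystem n m)

/-! ### The Lie algebras and the groups -/

/-- The dynamical Lie algebra: the real Lie algebra generated by `i H_d, i H_1, …, i H_m`. -/
noncomputable def dynAlgebra : LieSubalgebra ℝ (Matrix (Fin n) (Fin n) ℂ) :=
  LieSubalgebra.lieSpan ℝ _
    (insert (Complex.I • S.drift) (Set.range fun j => Complex.I • S.ctrl j))

/-- The control algebra: the real Lie algebra generated by `i H_1, …, i H_m`. -/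
noncomputable def ctrlAlgebra : LieSubalgebra ℝ (Matrix (Fin n) (Fin n) ℂ) :=
  LieSubalgebra.lieSpan ℝ _ (Set.range fun j => Complex.I • S.ctrl j)

/-- The subgroup of `SU(n)` generated by the exponentials of the elements of a Lie algebra. -/
noncomputable def expSubgroup (𝔩 : LieSubalgebra ℝ (Matrix (Fin n) (Fin n) ℂ)) :
    Subgroup (Matrix.specialUnitaryGroup (Fin n) ℂ) :=
  Subgroup.closure {U | ∃ X ∈ 𝔩, (U : Matrix (Fin n) (Fin n) ℂ) = NormedSpace.exp X}

/-- The dynamical group `G`. -/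
noncomputable def G : Subgroup (Matrix.specialUnitaryGroup (Fin n) ℂ) := expSubgroup S.dynAlgebra

/-- The control group `K`. -/
noncomputable def K : Subgroup (Matrix.specialUnitaryGroup (Fin n) ℂ) := expSubgroup S.ctrlAlgebra

/-- The matrix of an element of `G`. -/
abbrev mat (g : S.G) : Matrix (Fin n) (Fin n) ℂ := g.1.1

/-! ### The homogeneous space `G/K` -/

/-- The space `G/K` of right cosets `[g] = K g` with `g ∈ G`. -/
abbrev CosetSpace : Type := Quotient (QuotientGroup.rightRel (S.K.subgroupOf S.G))

/-- The projection `g ↦ [g] = K g`. -/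
noncomputable def proj (g : S.G) : S.CosetSpace := Quotient.mk _ g

theorem conjTranspose_of_mem_ctrlAlgebra {X : Matrix (Fin n) (Fin n) ℂ} (hX : X ∈ S.ctrlAlgebra) :
    Xᴴ = -X := by
  induction hX using LieSubalgebra.lieSpan_induction with
  | mem x h =>
    obtain ⟨j, rfl⟩ := h
    simp [Matrix.conjTranspose_smul, (S.ctrl_isHermitian j).eq]
  | zero => simp
  | add x y _ _ hx hy => simp [hx, hy, add_comm]
  | smul a x _ hx => simp [Matrix.conjTranspose_smul, hx]
  | lie x y _ _ hx hy => simp [Ring.lie_def, Matrix.conjTranspose_mul, hx, hy]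

theorem isCompl_ctrlAlgebra :
    IsCompl ((form n).orthogonal S.ctrlAlgebra.toSubmodule) S.ctrlAlgebra.toSubmodule := by
  refine (LinearMap.BilinForm.isCompl_orthogonal_iff_disjoint (form_isRefl n)).mpr ?_ |>.symm
  rw [Submodule.disjoint_def]
  intro X hX hX'
  exact eq_zero_of_form_self (S.conjTranspose_of_mem_ctrlAlgebra hX) (hX' X hX)

/-- The orthogonal projection along the control algebra `𝔨`. It maps `𝔤` onto `𝔭 = 𝔨^⊥ ∩ 𝔤`. As
`T_g(K g) = 𝔨 g`, it identifies `T_[g](G/K) = T_g G / T_g(K g)` with `𝔭`: the image of the tangent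
vector `X g` under the differential of `g ↦ [g]` is represented by `S.horizontalPart X`. -/
noncomputable def horizontalPart :
    Matrix (Fin n) (Fin n) ℂ →ₗ[ℝ] Matrix (Fin n) (Fin n) ℂ :=
  Submodule.projection _ _ S.isCompl_ctrlAlgebra

/-- The velocity `γ'(t)` of a curve of matrices on `[0, 1]` (one-sided at the end points). -/
noncomputable def velocity (γ : ℝ → S.G) (t : ℝ) : Matrix (Fin n) (Fin n) ℂ :=
  Matrix.of fun i j => derivWithin (fun s => S.mat (γ s) i j) (Set.Icc 0 1) t

/-- The velocity moved to the identity by right translation, `γ'(t) γ(t)⁻¹`. -/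
noncomputable def rightVelocity (γ : ℝ → S.G) (t : ℝ) : Matrix (Fin n) (Fin n) ℂ :=
  S.velocity γ t * S.mat (γ t)⁻¹

/-- `γ : [0, 1] → G` is a `C¹` curve in the Lie group `G`: its matrix entries are `C¹` and its
velocity is tangent to `G`, that is, `γ'(t) ∈ 𝔤 γ(t)`. (The values outside `[0, 1]` play no role.)
-/
structure IsCurve (γ : ℝ → S.G) : Prop where
  contDiffOn : ∀ i j, ContDiffOn ℝ 1 (fun s => S.mat (γ s) i j) (Set.Icc 0 1)
  tangent : ∀ t ∈ Set.Icc (0 : ℝ) 1, S.rightVelocity γ t ∈ S.dynAlgebra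

/-- The length of the curve `t ↦ [γ(t)]` in `G/K`, for the `G`-invariant Riemannian metric
`⟨X, Y⟩_[g] = ⟨X g⁻¹, Y g⁻¹⟩` on `T_[g](G/K) ≅ 𝔭`. -/
noncomputable def projLength (γ : ℝ → S.G) : ℝ≥0∞ :=
  ∫⁻ t in Set.Icc (0 : ℝ) 1, ENNReal.ofReal
    (Real.sqrt (form n (S.horizontalPart (S.rightVelocity γ t))
      (S.horizontalPart (S.rightVelocity γ t))))

/-- The Riemannian distance on `G/K`: the infimum of the lengths of the `C¹` curves joining two
points. Every `C¹` curve in `G/K` is the projection of a `C¹` curve in `G`. The value is `∞` if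
there is no curve. -/
noncomputable def cosetDist (x y : S.CosetSpace) : ℝ≥0∞ :=
  ⨅ (γ : ℝ → S.G) (_ : S.IsCurve γ) (_ : S.proj (γ 0) = x) (_ : S.proj (γ 1) = y), S.projLength γ

/-- The diameter of `G/K`. -/
noncomputable def cosetDiam : ℝ≥0∞ := ⨆ (x : S.CosetSpace) (y : S.CosetSpace), S.cosetDist x y

/-! ### The control problem and the quantum speed limit -/

/-- The Hamiltonian `H(t) = H_d + ∑ j, f_j(t) H_j`. -/
noncomputable def hamiltonian (f : Fin m → ℝ → ℝ) (t : ℝ) : Matrix (Fin n) (Fin n) ℂ :=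
  S.drift + ∑ j, f j t • S.ctrl j

/-- `U` solves the Schrödinger equation `i U' = H(t) U`, `U(0) = 1` on `[0, T]`, where the controls
`f_j` are arbitrary integrable functions. As these may be discontinuous, the equation is written in
its integrated form `U(t) = 1 + ∫₀ᵗ (-i) H(s) U(s) ds` (that is, `U` is absolutely continuous and
the differential equation holds almost everywhere). -/
structure IsEvolution (T : ℝ) (f : Fin m → ℝ → ℝ) (U : ℝ → Matrix (Fin n) (Fin n) ℂ) : Prop where
  integrable : ∀ j, IntervalIntegrable (f j) MeasureTheory.volume 0 T
  continuousOn : ContinuousOn U (Set.Icc 0 T)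
  schroedinger : ∀ t ∈ Set.Icc 0 T, ∀ a b, U t a b = (1 : Matrix (Fin n) (Fin n) ℂ) a b +
    ∫ s in (0 : ℝ)..t, ((-Complex.I) • (S.hamiltonian f s * U s)) a b

/-- The unitary `V` can be reached in time at most `T`, by some choice of the controls. -/
def ReachableWithin (T : ℝ) (V : Matrix (Fin n) (Fin n) ℂ) : Prop :=
  ∃ t ∈ Set.Icc 0 T, ∃ (f : Fin m → ℝ → ℝ) (U : ℝ → Matrix (Fin n) (Fin n) ℂ),
    S.IsEvolution t f U ∧ U t = V

/-- The quantum speed limit: the minimal time (infimum of the times `T ≥ 0`) within which every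
unitary of `G` can be reached; it is `∞` if there is no such time. -/
noncomputable def qslTime : ℝ≥0∞ :=
  ⨅ (T : ℝ) (_ : 0 ≤ T) (_ : ∀ g : S.G, S.ReachableWithin T (S.mat g)), ENNReal.ofReal T

end ControlSystem

/-! Moving inside a coset `K g` costs no length, so only the drift can move a point of `G/K`. Pass
to the frame that moves with the controls: write `U = w Q`, where formally `w' = C w` for the
control part `C` of `-i H(t)`, so that `w` lies in `K`, and `Q' = (wᴴ (-i H_d) w) Q`. Then `[U] =
[Q]`, and the right velocity of `Q` is a unitary conjugate of `-i H_d`, of constant norm `√(2n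
Tr(H_d²))`. Projecting to `𝔭` can only shorten it. If `b a⁻¹` is reached at time `t`, the curve `Q
a` therefore projects to a curve from `[a]` to `[b]` of length at most `t √(2n Tr(H_d²))`
(`cosetDist_proj_le`), and the supremum over `a`, `b` gives the bound.

Two points need work. First, the controls are merely integrable. In `exists_limit_solution`, `w` is
a uniform limit of solutions `V k` for continuous approximations of the control part; this is where
the closedness of `K` enters. No differential equation is proved for `w`: it is continuous, which
makes `Q` a `C¹` curve, and `IsEvolution.exists_eq_mul` obtains `U = w Q` at the final time by
comparing `U` with `V k * Q` through Grönwall's inequality.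

Second, `Q` has to stay in `G`, which is not assumed closed, so approximating `Q` by products of
exponentials would not suffice. Instead, `eventually_exists_eq_exp` shows that a curve tangent to
the right translates of a Lie algebra `𝔩` and passing through `1` lies in `exp 𝔩` itself near that
time, because its component transversal to `𝔩` in suitable coordinates has zero derivative. The
passage to all times is a connectedness argument (`mem_of_hasDerivAt_linear`). -/

open Filter Topology MeasureTheory

/-! ### Linear differential equations in a Banach algebra: Dyson series and Grönwall's inequality.
-/

section NormedAlgebra

variable {𝔸 : Type*} [NormedRing 𝔸] [NormedAlgebra ℝ 𝔸] [CompleteSpace 𝔸]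

/-- The iterated integrals of the Dyson series. -/
noncomputable def dysonTerm (A : ℝ → 𝔸) : ℕ → ℝ → 𝔸
  | 0 => fun _ => 1
  | k + 1 => fun t => ∫ s in (0 : ℝ)..t, A s * dysonTerm A k s

omit [CompleteSpace 𝔸] in
theorem continuous_dysonTerm {A : ℝ → 𝔸} (hA : Continuous A) (k : ℕ) :
    Continuous (dysonTerm A k) := by
  induction k with
  | zero => exact continuous_const
  | succ k ih =>
    exact intervalIntegral.continuous_primitive
      (fun a b => (hA.mul ih).intervalIntegrable a b) 0

theorem hasDerivAt_dysonTerm_succ {A : ℝ → 𝔸} (hA : Continuous A) (k : ℕ) (t : ℝ) :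
    HasDerivAt (dysonTerm A (k + 1)) (A t * dysonTerm A k t) t :=
  (hA.mul (continuous_dysonTerm hA k)).integral_hasStrictDerivAt 0 t |>.hasDerivAt

-- Each iterated integration of the constant bound `C` raises the power of `C * |t|` by one and
-- divides by the new exponent; this makes the Dyson series converge like the exponential series.
omit [CompleteSpace 𝔸] in
theorem norm_dysonTerm_le {A : ℝ → 𝔸} {C : ℝ} (hC : ∀ t, ‖A t‖ ≤ C) (k : ℕ) (t : ℝ) :
    ‖dysonTerm A k t‖ ≤ ‖(1 : 𝔸)‖ * ((C * |t|) ^ k / k.factorial) := by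
  have hC0 : 0 ≤ C := (norm_nonneg _).trans (hC 0)
  induction k generalizing t with
  | zero => simp [dysonTerm]
  | succ k ih =>
    have hcont : Continuous fun s : ℝ => C ^ (k + 1) * ‖(1 : 𝔸)‖ / k.factorial * |s - 0| ^ k := by
      fun_prop
    calc ‖dysonTerm A (k + 1) t‖
        ≤ ∫ s in Set.uIoc 0 t, C ^ (k + 1) * ‖(1 : 𝔸)‖ / k.factorial * |s - 0| ^ k := by
          refine intervalIntegral.norm_integral_le_integral_norm_uIoc.trans ?_
          refine integral_mono_of_nonneg (Eventually.of_forall fun s => norm_nonneg _) ?_ ?_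
          · exact (intervalIntegrable_iff.mp (hcont.intervalIntegrable 0 t))
          · refine Eventually.of_forall fun s => ?_
            refine (norm_mul_le _ _).trans ?_
            refine (mul_le_mul (hC s) (ih s) (norm_nonneg _) hC0).trans_eq ?_
            simp only [sub_zero, mul_pow]; ring
      _ = ‖(1 : 𝔸)‖ * ((C * |t|) ^ (k + 1) / (k + 1).factorial) := by
          rw [integral_const_mul, integral_pow_abs_sub_uIoc, Nat.factorial_succ, sub_zero]
          push_cast
          rw [mul_pow]
          field_simp

/-- Linear differential equations with bounded continuous coefficients have global solutions. -/
theorem exists_hasDerivAt_linear {A : ℝ → 𝔸} (hA : Continuous A) {C : ℝ} (hC : ∀ t, ‖A t‖ ≤ C) :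
    ∃ Q : ℝ → 𝔸, Q 0 = 1 ∧ ∀ t, HasDerivAt Q (A t * Q t) t := by
  have hC0 : 0 ≤ C := (norm_nonneg _).trans (hC 0)
  have hsum : ∀ t, Summable fun k => dysonTerm A k t := fun t =>
    Summable.of_norm_bounded ((Real.summable_pow_div_factorial (C * |t|)).mul_left ‖(1 : 𝔸)‖)
      fun k => norm_dysonTerm_le hC k t
  have key : ∀ t, ∑' k, dysonTerm A k t = 1 + ∑' k, dysonTerm A (k + 1) t := fun t => by
    rw [(hsum t).tsum_eq_zero_add]; rfl
  refine ⟨fun t => ∑' k, dysonTerm A k t, ?_, fun t => ?_⟩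
  · simp [key, dysonTerm]
  · have h1 : HasDerivAt (fun t => ∑' k, dysonTerm A (k + 1) t)
        (∑' k, A t * dysonTerm A k t) t := by
      -- The ball contains both `t` and the base point `0`, and on it the derivatives have a
      -- summable majorant independent of the point.
      refine hasDerivAt_tsum_of_isPreconnected
        (u := fun k => C * (‖(1 : 𝔸)‖ * ((C * (|t| + 1)) ^ k / k.factorial)))
        (t := Metric.ball 0 (|t| + 1)) (y₀ := 0) ?_ Metric.isOpen_ball
        (convex_ball (0 : ℝ) _).isPreconnected
        (fun k s _ => hasDerivAt_dysonTerm_succ hA k s) ?_ ?_ ?_ ?_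
      · exact ((Real.summable_pow_div_factorial _).mul_left _).mul_left _
      · intro k s hs
        rw [mem_ball_zero_iff, Real.norm_eq_abs] at hs
        refine (norm_mul_le _ _).trans (mul_le_mul (hC s) ?_ (norm_nonneg _) hC0)
        refine (norm_dysonTerm_le hC k s).trans ?_
        gcongr
      · simp; positivity
      · exact (summable_nat_add_iff 1).mpr (hsum 0)
      · simp
    rw [(hsum t).tsum_mul_left] at h1
    exact (h1.const_add 1).congr_of_eventuallyEq (Eventually.of_forall key)

/-- Grönwall's inequality in integral form. -/
theorem le_mul_exp_integral_of_le_add_integral {φ b : ℝ → ℝ} {ε T : ℝ} (hT : 0 ≤ T)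
    (hφ : Continuous φ) (hb : Continuous b) (hb0 : ∀ t, 0 ≤ b t)
    (h : ∀ t ∈ Set.Icc 0 T, φ t ≤ ε + ∫ s in (0 : ℝ)..t, b s * φ s) :
    φ T ≤ ε * Real.exp (∫ s in (0 : ℝ)..T, b s) := by
  set F : ℝ → ℝ := fun t => ε + ∫ s in (0 : ℝ)..t, b s * φ s
  set β : ℝ → ℝ := fun t => ∫ s in (0 : ℝ)..t, b s
  have hF : ∀ t, HasDerivAt F (b t * φ t) t := fun t =>
    (((hb.mul hφ).integral_hasStrictDerivAt 0 t).hasDerivAt).const_add ε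
  have hβ : ∀ t, HasDerivAt β (b t) t := fun t => (hb.integral_hasStrictDerivAt 0 t).hasDerivAt
  have hG : ∀ t, HasDerivAt (fun t => F t * Real.exp (-β t))
      (b t * φ t * Real.exp (-β t) + F t * (Real.exp (-β t) * -b t)) t := fun t =>
    (hF t).mul (hβ t).neg.exp
  -- The derivative of `F * exp (-β)` is `-b * exp (-β) * (F - φ)`, and `φ ≤ F` on the interval.
  have hanti : AntitoneOn (fun t => F t * Real.exp (-β t)) (Set.Icc 0 T) := by
    refine antitoneOn_of_deriv_nonpos (convex_Icc 0 T)
      (fun t _ => (hG t).continuousAt.continuousWithinAt)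
      (fun t _ => (hG t).differentiableAt.differentiableWithinAt) fun t ht => ?_
    rw [(hG t).deriv]
    have := h t (interior_subset ht)
    have h2 : 0 ≤ b t * Real.exp (-β t) * (F t - φ t) :=
      mul_nonneg (mul_nonneg (hb0 t) (Real.exp_pos _).le) (sub_nonneg.mpr this)
    nlinarith
  have h1 := hanti (Set.left_mem_Icc.mpr hT) (Set.right_mem_Icc.mpr hT) hT
  have h0 : F 0 * Real.exp (-β 0) = ε := by simp [F, β]
  simp only [h0] at h1
  refine (h T (Set.right_mem_Icc.mpr hT)).trans ?_
  change F T ≤ ε * Real.exp (β T)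
  rwa [Real.exp_neg, ← div_eq_mul_inv, div_le_iff₀ (Real.exp_pos _)] at h1

/-! ### Conjugation by exponentials and the derivative of `exp` along a closed Lie algebra. -/

section LieClosed

variable (𝔩 : Submodule ℝ 𝔸)

/-- A closed subspace contains the integrals of the functions with values in it. -/
theorem Submodule.intervalIntegral_mem (hcl : IsClosed (𝔩 : Set 𝔸)) {f : ℝ → 𝔸} {a b : ℝ}
    (hf : IntervalIntegrable f volume a b) (h : ∀ t, f t ∈ 𝔩) : ∫ t in a..b, f t ∈ 𝔩 := by
  have : IsClosed (𝔩 : Set 𝔸) := hcl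
  have := (𝔩.mkQL).intervalIntegral_comp_comm hf
  rw [← Submodule.Quotient.mk_eq_zero, ← Submodule.mkQ_apply]
  change 𝔩.mkQL _ = 0
  rw [← this]
  have h0 : ∀ t, 𝔩.mkQL (f t) = 0 := fun t => (Submodule.Quotient.mk_eq_zero 𝔩).mpr (h t)
  simp_rw [h0]
  exact intervalIntegral.integral_zero

variable {𝔩}

omit [CompleteSpace 𝔸] in
/-- The norm of a commutator modulo a subspace that is invariant under the commutation. -/
theorem norm_mkQ_commutator_le {X : 𝔸} (hX : ∀ Y ∈ 𝔩, X * Y - Y * X ∈ 𝔩) (Z : 𝔸) :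
    ‖(𝔩.mkQ (X * Z - Z * X))‖ ≤ 2 * ‖X‖ * ‖𝔩.mkQ Z‖ := by
  refine le_of_forall_pos_le_add fun ε hε => ?_
  have hδ : 0 < ε / (2 * ‖X‖ + 1) := by positivity
  -- A representative of almost minimal norm replaces `Z`; the commutator changes only by an element
  -- of `𝔩`. The `+ 1` covers `X = 0`.
  obtain ⟨Z', hZ', hlt⟩ := Submodule.Quotient.norm_mk_lt (S := 𝔩) (𝔩.mkQ Z) hδ
  have hmem : Z - Z' ∈ 𝔩 := by
    rw [← Submodule.Quotient.eq]
    exact hZ'.symm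
  have h1 : 𝔩.mkQ (X * Z - Z * X) = 𝔩.mkQ (X * Z' - Z' * X) := by
    rw [Submodule.mkQ_apply, Submodule.mkQ_apply, Submodule.Quotient.eq]
    have := hX _ hmem
    rwa [show X * (Z - Z') - (Z - Z') * X = X * Z - Z * X - (X * Z' - Z' * X) by noncomm_ring]
      at this
  rw [h1]
  calc ‖𝔩.mkQ (X * Z' - Z' * X)‖ ≤ ‖X * Z' - Z' * X‖ := Submodule.Quotient.norm_mk_le _ _
    _ ≤ ‖X‖ * ‖Z'‖ + ‖Z'‖ * ‖X‖ :=
      (norm_sub_le _ _).trans (add_le_add (norm_mul_le _ _) (norm_mul_le _ _))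
    _ = 2 * ‖X‖ * ‖Z'‖ := by ring
    _ ≤ 2 * ‖X‖ * (‖𝔩.mkQ Z‖ + ε / (2 * ‖X‖ + 1)) := by gcongr
    _ ≤ 2 * ‖X‖ * ‖𝔩.mkQ Z‖ + ε := by
      have : 2 * ‖X‖ * (ε / (2 * ‖X‖ + 1)) ≤ ε := by
        rw [mul_div_assoc', div_le_iff₀ (by positivity)]
        nlinarith [norm_nonneg X]
      linarith

theorem hasDerivAt_exp_smul_neg (X : 𝔸) (t : ℝ) :
    HasDerivAt (fun s : ℝ => NormedSpace.exp (s • -X)) (-(NormedSpace.exp (t • -X) * X)) t := by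
  simpa using hasDerivAt_exp_smul_const (𝕂 := ℝ) (-X) t

theorem exp_neg_mul_exp (X : 𝔸) : NormedSpace.exp (-X) * NormedSpace.exp X = 1 := by
  let := NormedAlgebra.restrictScalars ℚ ℝ 𝔸
  rw [← NormedSpace.exp_add_of_commute (Commute.refl X).neg_left, neg_add_cancel,
    NormedSpace.exp_zero]

/-- A closed subspace that is stable under commutation with `X` is stable under conjugation with
`exp X`. -/
theorem exp_mul_mul_exp_neg_mem (hcl : IsClosed (𝔩 : Set 𝔸)) {X Y : 𝔸}
    (hX : ∀ Y ∈ 𝔩, X * Y - Y * X ∈ 𝔩) (hY : Y ∈ 𝔩) :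
    NormedSpace.exp X * Y * NormedSpace.exp (-X) ∈ 𝔩 := by
  have : IsClosed (𝔩 : Set 𝔸) := hcl
  set y : ℝ → 𝔸 := fun s => NormedSpace.exp (s • X) * Y * NormedSpace.exp (s • -X) with hy
  have hd : ∀ s, HasDerivAt y (X * y s - y s * X) s := fun s => by
    have h := ((hasDerivAt_exp_smul_const' (𝕂 := ℝ) X s).mul_const Y).mul
      (hasDerivAt_exp_smul_neg X s)
    refine h.congr_deriv ?_
    simp only [hy]
    noncomm_ring
  have hq : ∀ s, HasDerivAt (fun s => 𝔩.mkQL (y s)) (𝔩.mkQL (X * y s - y s * X)) s := fun s =>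
    (𝔩.mkQL.hasFDerivAt.comp_hasDerivAt s (hd s))
  -- Modulo `𝔩`, the curve `y` starts at `0` and its derivative is bounded by a multiple of its
  -- norm, so it remains `0`.
  have h0 := eq_zero_of_abs_deriv_le_mul_abs_self_of_eq_zero_right (K := 2 * ‖X‖)
    (f := fun s => 𝔩.mkQL (y s)) (a := 0) (b := 1)
    (fun s _ => (hq s).continuousAt.continuousWithinAt)
    (fun s _ => (hq s).hasDerivWithinAt) (by simpa [hy] using hY)
    (fun s _ => norm_mkQ_commutator_le hX (y s)) 1 (by simp)
  simpa [hy] using h0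

/-- Duhamel's formula: integrate the derivative of `u ↦ exp ((1 - u) X) exp (u Y)`. -/
theorem exp_sub_exp_eq_integral (X Y : 𝔸) :
    NormedSpace.exp Y - NormedSpace.exp X = ∫ u in (0 : ℝ)..1,
      NormedSpace.exp ((1 - u) • X) * (Y - X) * NormedSpace.exp (u • Y) := by
  let := NormedAlgebra.restrictScalars ℚ ℝ 𝔸
  have hd : ∀ u : ℝ, HasDerivAt (fun u : ℝ => NormedSpace.exp ((1 - u) • X) *
      NormedSpace.exp (u • Y))
      (NormedSpace.exp ((1 - u) • X) * (Y - X) * NormedSpace.exp (u • Y)) u := fun u => by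
    have h1 : HasDerivAt (fun u : ℝ => NormedSpace.exp ((1 - u) • X))
        (-(NormedSpace.exp ((1 - u) • X) * X)) u := by
      refine ((hasDerivAt_exp_smul_const (𝕂 := ℝ) X (1 - u)).scomp u
        ((hasDerivAt_id u).const_sub 1)).congr_deriv ?_
      rw [neg_one_smul]
    refine (h1.mul (hasDerivAt_exp_smul_const' (𝕂 := ℝ) Y u)).congr_deriv ?_
    noncomm_ring
  have hc : Continuous fun u : ℝ =>
      NormedSpace.exp ((1 - u) • X) * (Y - X) * NormedSpace.exp (u • Y) := by
    have := NormedSpace.exp_continuous (𝔸 := 𝔸)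
    fun_prop
  rw [intervalIntegral.integral_eq_sub_of_hasDerivAt (fun u _ => hd u) (hc.intervalIntegrable 0 1)]
  simp

/-- The derivative of the exponential of a curve in a closed Lie algebra `𝔩` of matrices is the
left translate of an element of `𝔩`. -/
theorem exists_hasDerivAt_exp (hcl : IsClosed (𝔩 : Set 𝔸))
    (hlie : ∀ X ∈ 𝔩, ∀ Y ∈ 𝔩, X * Y - Y * X ∈ 𝔩) {x : ℝ → 𝔸} {x' : 𝔸} {s : ℝ}
    (hx : HasDerivAt x x' s) (hxs : x s ∈ 𝔩) (hx' : x' ∈ 𝔩) :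
    ∃ B ∈ 𝔩, HasDerivAt (fun t => NormedSpace.exp (x t)) (NormedSpace.exp (x s) * B) s := by
  let := NormedAlgebra.restrictScalars ℚ ℝ 𝔸
  have hexp := NormedSpace.exp_continuous (𝔸 := 𝔸)
  -- By Duhamel's formula the difference quotient of `exp ∘ x` at `s` is `Ψ (x t, slope x s t)`, so
  -- its limit follows from the joint continuity of `Ψ`.
  set Ψ : 𝔸 × 𝔸 → 𝔸 := fun p => ∫ u in (0 : ℝ)..1,
    NormedSpace.exp ((1 - u) • x s) * p.2 * NormedSpace.exp (u • p.1) with hΨ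
  have hΨc : Continuous Ψ := by
    refine intervalIntegral.continuous_parametric_intervalIntegral_of_continuous' ?_ 0 1
    simp only [Function.uncurry_def]
    fun_prop
  have hcB : Continuous fun u : ℝ =>
      NormedSpace.exp (-(u • x s)) * x' * NormedSpace.exp (u • x s) := by fun_prop
  refine ⟨∫ u in (0 : ℝ)..1, NormedSpace.exp (-(u • x s)) * x' * NormedSpace.exp (u • x s), ?_, ?_⟩
  · refine Submodule.intervalIntegral_mem 𝔩 hcl (hcB.intervalIntegrable 0 1) fun u => ?_
    have := exp_mul_mul_exp_neg_mem hcl (X := -(u • x s)) (Y := x')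
      (fun Y hY => hlie _ (neg_mem (𝔩.smul_mem u hxs)) Y hY) hx'
    simpa using this
  · have hval : NormedSpace.exp (x s) * ∫ u in (0 : ℝ)..1,
        NormedSpace.exp (-(u • x s)) * x' * NormedSpace.exp (u • x s) = Ψ (x s, x') := by
      rw [hΨ, ← ContinuousLinearMap.mul_apply' ℝ 𝔸, ←
        ContinuousLinearMap.intervalIntegral_comp_comm _ (hcB.intervalIntegrable 0 1)]
      refine intervalIntegral.integral_congr fun u _ => ?_
      simp only [ContinuousLinearMap.mul_apply', ← mul_assoc]
      rw [← NormedSpace.exp_add_of_commute (((Commute.refl (x s)).smul_right u).neg_right),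
        sub_smul, one_smul, sub_eq_add_neg]
    rw [hval, hasDerivAt_iff_tendsto_slope]
    have hlim : Tendsto (fun t => Ψ (x t, slope x s t)) (𝓝[≠] s) (𝓝 (Ψ (x s, x'))) := by
      refine (hΨc.tendsto _).comp (Tendsto.prodMk_nhds ?_ (hasDerivAt_iff_tendsto_slope.mp hx))
      exact hx.continuousAt.tendsto.mono_left nhdsWithin_le_nhds
    refine hlim.congr fun t => ?_
    rw [slope_def_module, slope_def_module, exp_sub_exp_eq_integral, hΨ,
      ← intervalIntegral.integral_smul]
    refine intervalIntegral.integral_congr fun u _ => ?_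
    simp only [mul_smul_comm, smul_mul_assoc]

end LieClosed

end NormedAlgebra

/-! ### Curves tangent to a Lie algebra stay in the group it generates. -/

section IntegralSubgroup

variable {𝔸 : Type*} [NormedRing 𝔸] [NormedAlgebra ℝ 𝔸] [CompleteSpace 𝔸] {𝔩 : Submodule ℝ 𝔸}

omit [CompleteSpace 𝔸] in
theorem Submodule.exists_continuousLinearMap_projection [FiniteDimensional ℝ 𝔸]
    (𝔩 : Submodule ℝ 𝔸) : ∃ p : 𝔸 →L[ℝ] 𝔸, (∀ v, p v ∈ 𝔩) ∧ ∀ v ∈ 𝔩, p v = v := by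
  obtain ⟨𝔠, hc⟩ := 𝔩.exists_isCompl
  exact ⟨LinearMap.toContinuousLinearMap (Submodule.projection 𝔩 𝔠 hc), fun v => by simp,
    fun v hv => by simp [hv]⟩

/-- Coordinates near the identity: every curve through `1` is locally of the form
`exp (p v) * (1 + (v - p v))`, where `p` is a given continuous linear map. -/
theorem exists_exp_mul_coordinates (p : 𝔸 →L[ℝ] 𝔸) {Q : ℝ → 𝔸} {s₀ : ℝ} (h0 : Q s₀ = 1)
    (hQ : Differentiable ℝ Q) :
    ∃ v : ℝ → 𝔸, v s₀ = 0 ∧ ∀ᶠ s in 𝓝 s₀, DifferentiableAt ℝ v s ∧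
      Q s = NormedSpace.exp (p (v s)) * (1 + (v s - p (v s))) := by
  let := NormedAlgebra.restrictScalars ℚ ℝ 𝔸
  set F : 𝔸 → 𝔸 := fun v => NormedSpace.exp (p v) * (1 + (v - p v)) with hF
  have hexp : ContDiff ℝ 1 (NormedSpace.exp : 𝔸 → 𝔸) :=
    contDiff_iff_contDiffAt.mpr fun x => (NormedSpace.exp_analytic (𝕂 := ℝ) x).contDiffAt
  have hFc : ContDiff ℝ 1 F := by
    refine (hexp.comp p.contDiff).mul (contDiff_const.add (contDiff_id.sub p.contDiff))
  have hF0 : F 0 = 1 := by simp [hF]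
  -- The two factors contribute `p` and `id - p`, which add up to the identity, so the inverse
  -- function theorem applies for every `p`.
  have hFd : HasFDerivAt F ((ContinuousLinearEquiv.refl ℝ 𝔸 : 𝔸 ≃L[ℝ] 𝔸) : 𝔸 →L[ℝ] 𝔸) 0 := by
    have h1 : HasFDerivAt (fun v => NormedSpace.exp (p v)) p 0 := by
      have : HasFDerivAt (NormedSpace.exp : 𝔸 → 𝔸) (1 : 𝔸 →L[ℝ] 𝔸) (p 0) := by
        rw [map_zero]; exact hasFDerivAt_exp_zero
      exact this.comp 0 p.hasFDerivAt
    have h2 : HasFDerivAt (fun v => 1 + (v - p v)) (ContinuousLinearMap.id ℝ 𝔸 - p) 0 :=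
      ((hasFDerivAt_id 0).sub p.hasFDerivAt).const_add 1
    refine (h1.mul' h2).congr_fderiv ?_
    ext v
    simp
  have hFa : ContDiffAt ℝ 1 F 0 := hFc.contDiffAt
  set g := hFa.localInverse hFd one_ne_zero with hg
  have hgc : ContDiffAt ℝ 1 g 1 := by
    have := hFa.to_localInverse hFd one_ne_zero
    rwa [hF0] at this
  have hQc : Tendsto Q (𝓝 s₀) (𝓝 1) := by
    rw [← h0]; exact (hQ s₀).continuousAt
  refine ⟨fun s => g (Q s), ?_, ?_⟩
  · simp only [h0, ← hF0]
    exact hFa.localInverse_apply_image hFd one_ne_zero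
  · have h1 : ∀ᶠ y in 𝓝 (1 : 𝔸), DifferentiableAt ℝ g y :=
      (hgc.eventually (by simp)).mono fun y hy => hy.differentiableAt one_ne_zero
    have h2 : ∀ᶠ y in 𝓝 (1 : 𝔸), F (g y) = y := by
      rw [← hF0]
      exact (hFa.hasStrictFDerivAt' hFd one_ne_zero).eventually_right_inverse
    filter_upwards [hQc.eventually h1, hQc.eventually h2] with s hs1 hs2
    exact ⟨hs1.comp s (hQ s), hs2.symm⟩

/-- A solution of `Q' = A Q` with `Q(s₀) = 1` and `A` with values in a Lie algebra `𝔩` stays in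
`exp 𝔩` near `s₀`. -/
theorem eventually_exists_eq_exp (hlie : ∀ X ∈ 𝔩, ∀ Y ∈ 𝔩, X * Y - Y * X ∈ 𝔩)
    (p : 𝔸 →L[ℝ] 𝔸) (hp : ∀ v, p v ∈ 𝔩) (hp' : ∀ v ∈ 𝔩, p v = v)
    {A Q : ℝ → 𝔸} {s₀ : ℝ} (h0 : Q s₀ = 1) (hA : ∀ t, A t ∈ 𝔩)
    (hQ : ∀ t, HasDerivAt Q (A t * Q t) t) :
    ∀ᶠ s in 𝓝 s₀, ∃ X ∈ 𝔩, Q s = NormedSpace.exp X := by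
  have hcl : IsClosed (𝔩 : Set 𝔸) := by
    have : (𝔩 : Set 𝔸) = {v | p v = v} :=
      Set.ext fun v => ⟨hp' v, fun h => by rw [← show p v = v from h]; exact hp v⟩
    rw [this]
    exact isClosed_eq p.continuous continuous_id
  obtain ⟨v, hv0, hv⟩ := exists_exp_mul_coordinates p h0 fun t => (hQ t).differentiableAt
  -- The component of the coordinates transversal to `𝔩`. It vanishes at `s₀`; the aim is `z' = 0`
  -- nearby.
  set z : ℝ → 𝔸 := fun s => v s - p (v s) with hz
  have hzc : Tendsto (fun s => ‖p‖ * ‖z s‖) (𝓝 s₀) (𝓝 0) := by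
    have hvc : ContinuousAt v s₀ := hv.self_of_nhds.1.continuousAt
    have : ContinuousAt (fun s => ‖p‖ * ‖v s - p (v s)‖) s₀ := by fun_prop
    simpa [ContinuousAt, hv0] using this
  obtain ⟨δ, hδ, hball⟩ := Metric.eventually_nhds_iff_ball.mp
    (hv.eventually_nhds.and (hzc.eventually (gt_mem_nhds zero_lt_one)))
  have hderiv : ∀ s ∈ Metric.ball s₀ δ, HasDerivAt z 0 s := by
    intro s hs
    obtain ⟨hvs, hlt⟩ := hball s hs
    have hvd : HasDerivAt v (deriv v s) s := hvs.self_of_nhds.1.hasDerivAt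
    have hpv : HasDerivAt (fun t => p (v t)) (p (deriv v s)) s := p.hasFDerivAt.comp_hasDerivAt s hvd
    have hzd : HasDerivAt z (deriv v s - p (deriv v s)) s := hvd.sub hpv
    obtain ⟨B, hB, hBd⟩ := exists_hasDerivAt_exp hcl hlie hpv (hp _) (hp _)
    set E := NormedSpace.exp (p (v s)) with hE
    set E' := NormedSpace.exp (-p (v s)) with hE'
    have hE'E : E' * E = 1 := exp_neg_mul_exp _
    have hQs : Q s = E * (1 + z s) := hvs.self_of_nhds.2
    have hQd : HasDerivAt Q (E * B * (1 + z s) + E * (deriv v s - p (deriv v s))) s :=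
      (hBd.mul (hzd.const_add 1)).congr_of_eventuallyEq (hvs.mono fun t ht => ht.2)
    have heq := (hQ s).unique hQd
    set C := E' * A s * E - B with hC
    have hCmem : C ∈ 𝔩 := by
      refine sub_mem ?_ hB
      have := exp_mul_mul_exp_neg_mem hcl (X := -p (v s)) (Y := A s)
        (fun Y hY => hlie _ (neg_mem (hp _)) Y hY) (hA s)
      rwa [neg_neg] at this
    -- Equate the two expressions for the derivative of `Q` and cancel `E` on the left.
    have hzeq : deriv v s - p (deriv v s) = C * (1 + z s) := by
      have hmul : ∀ x, E' * (E * x) = x := fun x => by rw [← mul_assoc, hE'E, one_mul]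
      have h1 := congrArg (E' * ·) heq
      simp only [hQs, mul_assoc E B, mul_add E', hmul] at h1
      rw [hC, sub_mul, eq_sub_iff_add_eq', ← h1]
      simp only [mul_assoc]
    -- Since `p` kills `z'` and fixes `C`, the equation gives `C = -p (C * z s)`; as `‖p‖ * ‖z s‖ <
    -- 1`, this forces `C = 0`.
    have hC0 : C = 0 := by
      have h1 : p (C * (1 + z s)) = 0 := by
        rw [← hzeq, map_sub, hp' _ (hp _), sub_self]
      rw [mul_add, mul_one, map_add, hp' C hCmem] at h1
      have h2 : ‖C‖ ≤ ‖C‖ * (‖p‖ * ‖z s‖) := by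
        calc ‖C‖ = ‖p (C * z s)‖ := by
              rw [← norm_neg (p _)]; exact congrArg _ (eq_neg_of_add_eq_zero_left h1)
          _ ≤ ‖p‖ * (‖C‖ * ‖z s‖) := (p.le_opNorm _).trans (by gcongr; exact norm_mul_le _ _)
          _ = _ := by ring
      have h3 : ‖C‖ ≤ 0 := by nlinarith [norm_nonneg C]
      exact norm_le_zero_iff.mp h3
    rw [hzeq, hC0, zero_mul] at hzd
    exact hzd
  refine Metric.eventually_nhds_iff_ball.mpr ⟨δ, hδ, fun s hs => ?_⟩
  have hconst : z s = z s₀ := by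
    refine (convex_ball s₀ δ).is_const_of_fderivWithin_eq_zero (𝕜 := ℝ)
      (fun t ht => (hderiv t ht).differentiableAt.differentiableWithinAt) (fun t ht => ?_) hs
      (Metric.mem_ball_self hδ)
    rw [fderivWithin_of_isOpen Metric.isOpen_ball ht]
    ext
    simp [(hderiv t ht).deriv]
  refine ⟨p (v s), hp _, ?_⟩
  have h1 := (hball s hs).1.self_of_nhds.2
  have h2 : v s - p (v s) = 0 := by simpa [hz, hv0] using hconst
  rwa [h2, add_zero, mul_one] at h1

/-- A solution of `Q' = A Q` with `Q(0) = 1` and `A` with values in a Lie algebra `𝔩` stays in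
every submonoid that contains `exp 𝔩`. -/
theorem mem_of_hasDerivAt_linear [FiniteDimensional ℝ 𝔸]
    (hlie : ∀ X ∈ 𝔩, ∀ Y ∈ 𝔩, X * Y - Y * X ∈ 𝔩) {H : Submonoid 𝔸}
    (hH : ∀ X ∈ 𝔩, NormedSpace.exp X ∈ H) {A Q : ℝ → 𝔸} (h0 : Q 0 = 1) (hA : ∀ t, A t ∈ 𝔩)
    (hQ : ∀ t, HasDerivAt Q (A t * Q t) t) (hu : ∀ t, IsUnit (Q t)) (t : ℝ) : Q t ∈ H := by
  obtain ⟨p, hp, hp'⟩ := Submodule.exists_continuousLinearMap_projection 𝔩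
  have hloc : ∀ s₀, ∀ᶠ s in 𝓝 s₀, (Q s ∈ H ↔ Q s₀ ∈ H) := fun s₀ => by
    obtain ⟨u, hu⟩ := hu s₀
    -- Right translation by `(Q s₀)⁻¹` preserves the equation and makes the curve pass through `1`
    -- at `s₀`, as the local result requires.
    have h1 : ∀ t, HasDerivAt (fun t => Q t * ((u⁻¹ : 𝔸ˣ) : 𝔸)) (A t * (Q t * ((u⁻¹ : 𝔸ˣ) : 𝔸))) t :=
      fun t => by
        rw [← mul_assoc]
        exact (hQ t).mul_const _
    filter_upwards [eventually_exists_eq_exp hlie p hp hp' (by rw [← hu, Units.mul_inv]) hA h1]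
      with s ⟨X, hX, hs⟩
    have h2 : Q s = NormedSpace.exp X * Q s₀ := by
      rw [← hs, ← hu, mul_assoc, Units.inv_mul, mul_one]
    have h3 : NormedSpace.exp (-X) * Q s = Q s₀ := by
      rw [h2, ← mul_assoc, exp_neg_mul_exp, one_mul]
    refine ⟨fun h => ?_, fun h => ?_⟩
    · rw [← h3]; exact mul_mem (hH _ (neg_mem hX)) h
    · rw [h2]; exact mul_mem (hH _ hX) h
  have hclopen : IsClopen {s | Q s ∈ H} := by
    refine ⟨⟨isOpen_iff_mem_nhds.mpr fun s hs => ?_⟩, isOpen_iff_mem_nhds.mpr fun s hs => ?_⟩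
    · filter_upwards [hloc s] with r hr
      exact fun h => hs (hr.mp h)
    · filter_upwards [hloc s] with r hr
      exact hr.mpr hs
  exact Set.eq_univ_iff_forall.mp (hclopen.eq_univ ⟨0, by simp [h0]⟩) t

end IntegralSubgroup

/-! ### Matrix Lie algebras inside `𝔰𝔲(n)` and their groups. -/

namespace ControlSystem

open scoped Matrix.Norms.L2Operator

/-- The operator norm makes the complex matrices a normed algebra over the reals. -/
noncomputable local instance matrixRealNormedAlgebra (n : ℕ) :
    NormedAlgebra ℝ (Matrix (Fin n) (Fin n) ℂ) :=
  { Matrix.instAlgebra with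
    norm_smul_le := fun r X => by
      have h : r • X = (r : ℂ) • X := by ext i j; simp
      rw [h, norm_smul, Complex.norm_real] }

variable {n m : ℕ}

/-- The Lie algebra `𝔰𝔲(n)` of the traceless skew-Hermitian matrices. -/
noncomputable def suAlgebra (n : ℕ) : LieSubalgebra ℝ (Matrix (Fin n) (Fin n) ℂ) where
  carrier := {X | Xᴴ = -X ∧ X.trace = 0}
  zero_mem' := by simp
  add_mem' := by
    rintro X Y ⟨hX, hX'⟩ ⟨hY, hY'⟩
    simp [hX, hY, hX', hY', add_comm]
  smul_mem' := by
    rintro c X ⟨hX, hX'⟩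
    simp [Matrix.conjTranspose_smul, hX, hX']
  lie_mem' := by
    rintro X Y ⟨hX, hX'⟩ ⟨hY, hY'⟩
    refine ⟨?_, ?_⟩
    · simp [Ring.lie_def, Matrix.conjTranspose_mul, hX, hY]
    · simp [Ring.lie_def, Matrix.trace_mul_comm X Y]

theorem mem_suAlgebra {X : Matrix (Fin n) (Fin n) ℂ} :
    X ∈ suAlgebra n ↔ Xᴴ = -X ∧ X.trace = 0 := Iff.rfl

theorem smul_I_mem_suAlgebra {X : Matrix (Fin n) (Fin n) ℂ} (h : X.IsHermitian)
    (h' : X.trace = 0) : Complex.I • X ∈ suAlgebra n := by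
  simp [mem_suAlgebra, Matrix.conjTranspose_smul, h.eq, h']

theorem dynAlgebra_le_suAlgebra (S : ControlSystem n m) : S.dynAlgebra ≤ suAlgebra n := by
  refine LieSubalgebra.lieSpan_le.mpr (Set.insert_subset ?_ ?_)
  · exact smul_I_mem_suAlgebra S.drift_isHermitian S.drift_trace
  · rintro _ ⟨j, rfl⟩
    exact smul_I_mem_suAlgebra (S.ctrl_isHermitian j) (S.ctrl_trace j)

theorem ctrlAlgebra_le_dynAlgebra (S : ControlSystem n m) : S.ctrlAlgebra ≤ S.dynAlgebra :=
  LieSubalgebra.lieSpan_mono (Set.subset_insert _ _)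

/-- Diagonalise the Hermitian matrix `-i X`: the determinant of the exponential is the exponential
of the trace, which is zero. -/
theorem det_exp_eq_one {X : Matrix (Fin n) (Fin n) ℂ} (hX : X ∈ suAlgebra n) :
    (NormedSpace.exp X).det = 1 := by
  have hH : ((-Complex.I) • X).IsHermitian := by
    simp [Matrix.IsHermitian, Matrix.conjTranspose_smul, hX.1]
  set V := hH.eigenvectorUnitary
  set D : Matrix (Fin n) (Fin n) ℂ := Matrix.diagonal fun i => Complex.I * hH.eigenvalues i with hD
  have h1 : X = (V : Matrix (Fin n) (Fin n) ℂ) * D * star (V : Matrix (Fin n) (Fin n) ℂ) := by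
    have h := hH.spectral_theorem
    rw [Unitary.conjStarAlgAut_apply] at h
    have h2 : X = Complex.I • ((-Complex.I) • X) := by simp [smul_smul]
    have h3 : D = Complex.I • Matrix.diagonal ((RCLike.ofReal : ℝ → ℂ) ∘ hH.eigenvalues) := by
      ext i j
      simp [hD, Matrix.diagonal_apply]
    rw [h2, h, h3, mul_smul_comm, smul_mul_assoc]
  have hVV : star (V : Matrix (Fin n) (Fin n) ℂ) * V = 1 := Unitary.coe_star_mul_self V
  have hinv : star (V : Matrix (Fin n) (Fin n) ℂ) = (V : Matrix (Fin n) (Fin n) ℂ)⁻¹ :=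
    (Matrix.inv_eq_left_inv hVV).symm
  have hu : IsUnit (V : Matrix (Fin n) (Fin n) ℂ) := IsUnit.of_mul_eq_one_right _ hVV
  have htr : ∑ i, Complex.I * (hH.eigenvalues i : ℂ) = 0 := by
    have h := hX.2
    rw [h1, Matrix.trace_mul_cycle, hVV, one_mul] at h
    simpa [hD] using h
  rw [h1, hinv, Matrix.exp_conj _ _ hu, Matrix.det_conj hu, hD, Matrix.exp_diagonal,
    Matrix.det_diagonal]
  simp only [Pi.exp_def, ← Complex.exp_eq_exp_ℂ]
  rw [← Complex.exp_sum, htr, Complex.exp_zero]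

theorem exp_mem_specialUnitaryGroup {X : Matrix (Fin n) (Fin n) ℂ} (hX : X ∈ suAlgebra n) :
    NormedSpace.exp X ∈ Matrix.specialUnitaryGroup (Fin n) ℂ := by
  let := NormedAlgebra.restrictScalars ℚ ℝ (Matrix (Fin n) (Fin n) ℂ)
  refine Matrix.mem_specialUnitaryGroup_iff.mpr ⟨?_, det_exp_eq_one hX⟩
  exact NormedSpace.exp_mem_unitary_of_mem_skewAdjoint (skewAdjoint.mem_iff.mpr hX.1)

theorem mul_star_self_coe (g : Matrix.specialUnitaryGroup (Fin n) ℂ) :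
    (g : Matrix (Fin n) (Fin n) ℂ) * (g : Matrix (Fin n) (Fin n) ℂ)ᴴ = 1 :=
  Unitary.mul_star_self_of_mem g.2.1

theorem coe_inv_eq (g : Matrix.specialUnitaryGroup (Fin n) ℂ) :
    ((g⁻¹ : Matrix.specialUnitaryGroup (Fin n) ℂ) : Matrix (Fin n) (Fin n) ℂ) =
      (g : Matrix (Fin n) (Fin n) ℂ)ᴴ := rfl

theorem norm_coe_le_one (g : Matrix.specialUnitaryGroup (Fin n) ℂ) :
    ‖(g : Matrix (Fin n) (Fin n) ℂ)‖ ≤ 1 := by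
  rcases subsingleton_or_nontrivial (Matrix (Fin n) (Fin n) ℂ) with h | h
  · rw [Subsingleton.elim (g : Matrix (Fin n) (Fin n) ℂ) 0, norm_zero]; exact zero_le_one
  · exact (CStarRing.norm_of_mem_unitary g.2.1).le

theorem norm_conjTranspose_coe_le_one (g : Matrix.specialUnitaryGroup (Fin n) ℂ) :
    ‖(g : Matrix (Fin n) (Fin n) ℂ)ᴴ‖ ≤ 1 := norm_coe_le_one g⁻¹

theorem lie_closed (𝔩 : LieSubalgebra ℝ (Matrix (Fin n) (Fin n) ℂ)) :
    ∀ X ∈ 𝔩.toSubmodule, ∀ Y ∈ 𝔩.toSubmodule, X * Y - Y * X ∈ 𝔩.toSubmodule :=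
  fun _ hX _ hY => 𝔩.lie_mem hX hY

/-- Conjugation by the elements of the group of a subalgebra preserves the algebra. -/
theorem conj_mem {𝔨 𝔤 : LieSubalgebra ℝ (Matrix (Fin n) (Fin n) ℂ)} (hle : 𝔨 ≤ 𝔤)
    {g : Matrix.specialUnitaryGroup (Fin n) ℂ} (hg : g ∈ expSubgroup 𝔨)
    {Y : Matrix (Fin n) (Fin n) ℂ} (hY : Y ∈ 𝔤) :
    (g : Matrix (Fin n) (Fin n) ℂ)ᴴ * Y * g ∈ 𝔤 := by
  -- Both directions of conjugation are carried along so that the induction passes through inverses.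
  suffices h : ∀ Y ∈ 𝔤, (g : Matrix (Fin n) (Fin n) ℂ)ᴴ * Y * g ∈ 𝔤 ∧
      (g : Matrix (Fin n) (Fin n) ℂ) * Y * (g : Matrix (Fin n) (Fin n) ℂ)ᴴ ∈ 𝔤 from (h Y hY).1
  clear hY Y
  induction hg using Subgroup.closure_induction with
  | mem g hg =>
    obtain ⟨X, hX, hgX⟩ := hg
    have hcl : IsClosed (𝔤.toSubmodule : Set (Matrix (Fin n) (Fin n) ℂ)) :=
      𝔤.toSubmodule.closed_of_finiteDimensional
    have hstar : (g : Matrix (Fin n) (Fin n) ℂ)ᴴ = NormedSpace.exp (-X) := by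
      have h1 : NormedSpace.exp (-X) * (g : Matrix (Fin n) (Fin n) ℂ) = 1 := by
        rw [hgX]; exact exp_neg_mul_exp X
      calc (g : Matrix (Fin n) (Fin n) ℂ)ᴴ
          = NormedSpace.exp (-X) * (g : Matrix (Fin n) (Fin n) ℂ) *
            (g : Matrix (Fin n) (Fin n) ℂ)ᴴ := by rw [h1, one_mul]
        _ = _ := by rw [mul_assoc, mul_star_self_coe, mul_one]
    intro Y hY
    rw [hstar, hgX]
    refine ⟨?_, exp_mul_mul_exp_neg_mem hcl (fun Z hZ => 𝔤.lie_mem (hle hX) hZ) hY⟩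
    have := exp_mul_mul_exp_neg_mem hcl (X := -X)
      (fun Z hZ => 𝔤.lie_mem (neg_mem (hle hX)) hZ) hY
    rwa [neg_neg] at this
  | one => intro Y hY; simpa using hY
  | mul g h _ _ ihg ihh =>
    intro Y hY
    refine ⟨?_, ?_⟩
    · have := (ihh _ (ihg Y hY).1).1
      simpa [Matrix.conjTranspose_mul, mul_assoc] using this
    · have := (ihg _ (ihh Y hY).2).2
      simpa [Matrix.conjTranspose_mul, mul_assoc] using this
  | inv g _ ih =>
    intro Y hY
    rw [coe_inv_eq, Matrix.conjTranspose_conjTranspose]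
    exact (ih Y hY).symm

/-- Solutions of `Q' = A Q` with `A` skew-Hermitian preserve `Qᴴ Q`. -/
theorem conjTranspose_mul_self_of_hasDerivAt {A Q : ℝ → Matrix (Fin n) (Fin n) ℂ}
    (hA : ∀ t, (A t)ᴴ = -A t) (hQ : ∀ t, HasDerivAt Q (A t * Q t) t) (h0 : Q 0 = 1) (t : ℝ) :
    (Q t)ᴴ * Q t = 1 := by
  have hd : ∀ t, HasDerivAt (fun t => (Q t)ᴴ * Q t) 0 t := fun t => by
    have h1 : HasDerivAt (fun t => (Q t)ᴴ) ((A t * Q t)ᴴ) t := (hQ t).star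
    refine (h1.mul (hQ t)).congr_deriv ?_
    rw [Matrix.conjTranspose_mul, hA]
    noncomm_ring
  have := is_const_of_deriv_eq_zero (fun t => (hd t).differentiableAt) (fun t => (hd t).deriv) t 0
  simpa [h0] using this

/-- The solutions of `Q' = A Q`, `Q(0) = 1`, for continuous `A` with values in a Lie algebra `𝔩`,
exist and take values in the group generated by `exp 𝔩`. -/
theorem exists_solution_expSubgroup {𝔩 : LieSubalgebra ℝ (Matrix (Fin n) (Fin n) ℂ)}
    (hle : 𝔩 ≤ suAlgebra n) {A : ℝ → Matrix (Fin n) (Fin n) ℂ} (hA : Continuous A)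
    (hA' : ∀ t, A t ∈ 𝔩) {C : ℝ} (hC : ∀ t, ‖A t‖ ≤ C) :
    ∃ Q : ℝ → Matrix.specialUnitaryGroup (Fin n) ℂ, (∀ t, Q t ∈ expSubgroup 𝔩) ∧ Q 0 = 1 ∧
      ∀ t, HasDerivAt (fun t => (Q t : Matrix (Fin n) (Fin n) ℂ))
        (A t * (Q t : Matrix (Fin n) (Fin n) ℂ)) t := by
  obtain ⟨Q, h0, hQ⟩ := exists_hasDerivAt_linear hA hC
  have hu : ∀ t, IsUnit (Q t) := fun t => IsUnit.of_mul_eq_one_right _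
    (conjTranspose_mul_self_of_hasDerivAt (fun t => (hle (hA' t)).1) hQ h0 t)
  set H := (expSubgroup 𝔩).toSubmonoid.map (Matrix.specialUnitaryGroup (Fin n) ℂ).subtype
  have hH : ∀ X ∈ 𝔩.toSubmodule, NormedSpace.exp X ∈ H := fun X hX =>
    ⟨⟨NormedSpace.exp X, exp_mem_specialUnitaryGroup (hle hX)⟩,
      Subgroup.subset_closure ⟨X, hX, rfl⟩, rfl⟩
  have hmem : ∀ t, Q t ∈ H := mem_of_hasDerivAt_linear (lie_closed 𝔩) hH h0 hA' hQ hu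
  choose R hR hRQ using hmem
  have hRQ' : ∀ t, (R t : Matrix (Fin n) (Fin n) ℂ) = Q t := hRQ
  refine ⟨R, hR, Subtype.ext ((hRQ' 0).trans h0), fun t => ?_⟩
  simp only [hRQ']
  exact hQ t

/-! ### Integrable coefficients: approximation in the mean and limits of solutions. -/

/-- Integrable functions with values in a subspace `𝔩` are approximated in the mean by bounded
continuous functions with values in `𝔩`. -/
theorem exists_continuous_approx {𝔩 : Submodule ℝ (Matrix (Fin n) (Fin n) ℂ)}
    {B : ℝ → Matrix (Fin n) (Fin n) ℂ} (hB : ∀ t, B t ∈ 𝔩) {T : ℝ} (hT : 0 ≤ T)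
    (hBi : IntervalIntegrable B volume 0 T) {ε : ℝ} (hε : 0 < ε) :
    ∃ B' : ℝ → Matrix (Fin n) (Fin n) ℂ, Continuous B' ∧ (∀ t, B' t ∈ 𝔩) ∧
      (∃ C, ∀ t, ‖B' t‖ ≤ C) ∧ ∫ t in (0 : ℝ)..T, ‖B t - B' t‖ ≤ ε := by
  obtain ⟨p, hp, hp'⟩ := Submodule.exists_continuousLinearMap_projection 𝔩
  have hint : IntegrableOn B (Set.Ioc 0 T) := (intervalIntegrable_iff_integrableOn_Ioc_of_le hT).mp hBi
  -- The approximant is pushed into `𝔩` by the projection `p`, which enlarges the error by at most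
  -- `‖p‖`.
  have hδ : 0 < ε / (‖p‖ + 1) := by positivity
  obtain ⟨g, hgs, hg, hgc, hgi⟩ :=
    ((integrable_indicator_iff measurableSet_Ioc).mpr hint).exists_hasCompactSupport_integral_sub_le
      hδ
  obtain ⟨C, hC⟩ := hgs.exists_bound_of_continuous hgc
  refine ⟨fun t => p (g t), p.continuous.comp hgc, fun t => hp _, ⟨‖p‖ * C, fun t =>
    (p.le_opNorm _).trans (by gcongr; exact hC t)⟩, ?_⟩
  have hdi : Integrable fun t => ‖(Set.Ioc 0 T).indicator B t - g t‖ :=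
    (((integrable_indicator_iff measurableSet_Ioc).mpr hint).sub hgi).norm
  calc ∫ t in (0 : ℝ)..T, ‖B t - p (g t)‖
      = ∫ t in Set.Ioc 0 T, ‖B t - p (g t)‖ := intervalIntegral.integral_of_le hT
    _ ≤ ∫ t in Set.Ioc 0 T, ‖p‖ * ‖(Set.Ioc 0 T).indicator B t - g t‖ := by
        refine setIntegral_mono_on ?_ (hdi.const_mul _).integrableOn measurableSet_Ioc fun t ht => ?_
        · exact (hint.sub (p.integrable_comp hgi).integrableOn).norm
        · rw [Set.indicator_of_mem ht, ← hp' _ (hB t), ← map_sub, hp' _ (hB t)]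
          exact p.le_opNorm _
    _ ≤ ∫ t, ‖p‖ * ‖(Set.Ioc 0 T).indicator B t - g t‖ :=
        setIntegral_le_integral (hdi.const_mul _)
          (Eventually.of_forall fun t => by positivity)
    _ ≤ ‖p‖ * (ε / (‖p‖ + 1)) := by
        rw [integral_const_mul]
        gcongr
    _ ≤ ε := by
        rw [mul_div_assoc', div_le_iff₀ (by positivity)]
        nlinarith [norm_nonneg p]

/-- The solutions of `V' = B V` depend continuously on `B` in the mean. -/
theorem norm_solution_sub_le {B B' : ℝ → Matrix (Fin n) (Fin n) ℂ}
    {V V' : ℝ → Matrix.specialUnitaryGroup (Fin n) ℂ} (hB : Continuous B) (hB' : Continuous B')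
    (hs : ∀ t, (B t)ᴴ = -B t) (h0 : V 0 = 1) (h0' : V' 0 = 1)
    (hV : ∀ t, HasDerivAt (fun t => (V t : Matrix (Fin n) (Fin n) ℂ))
      (B t * (V t : Matrix (Fin n) (Fin n) ℂ)) t)
    (hV' : ∀ t, HasDerivAt (fun t => (V' t : Matrix (Fin n) (Fin n) ℂ))
      (B' t * (V' t : Matrix (Fin n) (Fin n) ℂ)) t) {t : ℝ} (ht : 0 ≤ t) :
    ‖(V' t : Matrix (Fin n) (Fin n) ℂ) - V t‖ ≤ ∫ s in (0 : ℝ)..t, ‖B' s - B s‖ := by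
  have hVc : Continuous fun t => (V t : Matrix (Fin n) (Fin n) ℂ) :=
    continuous_iff_continuousAt.mpr fun t => (hV t).continuousAt
  have hVc' : Continuous fun t => (V' t : Matrix (Fin n) (Fin n) ℂ) :=
    continuous_iff_continuousAt.mpr fun t => (hV' t).continuousAt
  -- Variation of constants: since `V` and `V'` are unitary, the difference is bounded by the
  -- integral of `‖B' - B‖` without an exponential factor.
  have hd : ∀ s, HasDerivAt (fun s => (V s : Matrix (Fin n) (Fin n) ℂ)ᴴ *
      (V' s : Matrix (Fin n) (Fin n) ℂ)) ((V s : Matrix (Fin n) (Fin n) ℂ)ᴴ * (B' s - B s) *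
        (V' s : Matrix (Fin n) (Fin n) ℂ)) s := fun s => by
    have h1 : HasDerivAt (fun t => (V t : Matrix (Fin n) (Fin n) ℂ)ᴴ)
      ((B s * (V s : Matrix (Fin n) (Fin n) ℂ))ᴴ) s := (hV s).star
    refine (h1.mul (hV' s)).congr_deriv ?_
    rw [Matrix.conjTranspose_mul, hs]
    noncomm_ring
  have hc : Continuous fun s => (V s : Matrix (Fin n) (Fin n) ℂ)ᴴ * (B' s - B s) *
        (V' s : Matrix (Fin n) (Fin n) ℂ) := by
    have : Continuous fun s => (V s : Matrix (Fin n) (Fin n) ℂ)ᴴ := hVc.star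
    fun_prop
  have hint := intervalIntegral.integral_eq_sub_of_hasDerivAt (fun s _ => hd s)
    (hc.intervalIntegrable 0 t)
  have h1 : (V' t : Matrix (Fin n) (Fin n) ℂ) - V t = V t * ∫ s in (0 : ℝ)..t,
      (V s : Matrix (Fin n) (Fin n) ℂ)ᴴ * (B' s - B s) * (V' s : Matrix (Fin n) (Fin n) ℂ) := by
    rw [hint, h0, h0', mul_sub, ← mul_assoc, mul_star_self_coe]
    simp
  rw [h1]
  calc _ ≤ 1 * ‖∫ s in (0 : ℝ)..t,
      (V s : Matrix (Fin n) (Fin n) ℂ)ᴴ * (B' s - B s) * (V' s : Matrix (Fin n) (Fin n) ℂ)‖ :=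
        (norm_mul_le _ _).trans (by gcongr; exact norm_coe_le_one _)
    _ ≤ ∫ s in (0 : ℝ)..t, ‖(V s : Matrix (Fin n) (Fin n) ℂ)ᴴ * (B' s - B s) *
        (V' s : Matrix (Fin n) (Fin n) ℂ)‖ := by
        rw [one_mul]; exact intervalIntegral.norm_integral_le_integral_norm ht
    _ ≤ ∫ s in (0 : ℝ)..t, ‖B' s - B s‖ := by
        refine intervalIntegral.integral_mono_on ht (hc.norm.intervalIntegrable 0 t)
          ((hB'.sub hB).norm.intervalIntegrable 0 t) fun s _ => ?_
        calc _ ≤ 1 * ‖B' s - B s‖ * 1 := by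
              refine (norm_mul_le _ _).trans ?_
              gcongr
              · refine (norm_mul_le _ _).trans ?_
                gcongr
                exact norm_conjTranspose_coe_le_one _
              · exact norm_coe_le_one _
          _ = _ := by ring

theorem isClosed_specialUnitaryGroup :
    IsClosed (Matrix.specialUnitaryGroup (Fin n) ℂ : Set (Matrix (Fin n) (Fin n) ℂ)) := by
  have : (Matrix.specialUnitaryGroup (Fin n) ℂ : Set (Matrix (Fin n) (Fin n) ℂ)) =
      {X | X * Xᴴ = 1} ∩ {X | X.det = 1} := by
    ext X
    simp [Matrix.mem_specialUnitaryGroup_iff, Matrix.mem_unitaryGroup_iff, Matrix.star_eq_conjTranspose]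
  rw [this]
  exact (isClosed_eq (continuous_id.mul continuous_star) continuous_const).inter
    (isClosed_eq continuous_id.matrix_det continuous_const)

/-- For an integrable function `B` with values in a Lie algebra `𝔩` whose group is closed, the
equation `W' = B W`, `W(0) = 1` has a generalized solution in the group: a uniform limit of the
solutions for continuous functions that approximate `B` in the mean. -/
theorem exists_limit_solution {𝔩 : LieSubalgebra ℝ (Matrix (Fin n) (Fin n) ℂ)}
    (hle : 𝔩 ≤ suAlgebra n)
    (hcl : IsClosed (expSubgroup 𝔩 : Set (Matrix.specialUnitaryGroup (Fin n) ℂ)))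
    {B : ℝ → Matrix (Fin n) (Fin n) ℂ} (hB : ∀ t, B t ∈ 𝔩) {T : ℝ} (hT : 0 ≤ T)
    (hBi : IntervalIntegrable B volume 0 T) :
    ∃ (W : ℝ → Matrix.specialUnitaryGroup (Fin n) ℂ) (B' : ℕ → ℝ → Matrix (Fin n) (Fin n) ℂ)
      (V : ℕ → ℝ → Matrix.specialUnitaryGroup (Fin n) ℂ),
      (∀ t, W t ∈ expSubgroup 𝔩) ∧ Continuous (fun t => (W t : Matrix (Fin n) (Fin n) ℂ)) ∧
      ∀ k : ℕ, Continuous (B' k) ∧ V k 0 = 1 ∧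
        (∀ t, HasDerivAt (fun t => (V k t : Matrix (Fin n) (Fin n) ℂ))
          (B' k t * (V k t : Matrix (Fin n) (Fin n) ℂ)) t) ∧
        ∫ t in (0 : ℝ)..T, ‖B t - B' k t‖ ≤ 1 / ((k : ℝ) + 1) ∧
        ∀ t ∈ Set.Icc 0 T, ‖(V k t : Matrix (Fin n) (Fin n) ℂ) - W t‖ ≤ 1 / ((k : ℝ) + 1) := by
  choose B' hB'c hB'm hB'b hB'i using fun k : ℕ => exists_continuous_approx
    (𝔩 := 𝔩.toSubmodule) hB hT hBi (Nat.one_div_pos_of_nat (α := ℝ) (n := k))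
  choose C hC using hB'b
  choose V hVm hV0 hVd using fun k => exists_solution_expSubgroup hle (hB'c k) (hB'm k) (hC k)
  have hdist : ∀ k l : ℕ, ∀ t ∈ Set.Icc 0 T, ‖(V k t : Matrix (Fin n) (Fin n) ℂ) - V l t‖ ≤
      1 / ((k : ℝ) + 1) + 1 / ((l : ℝ) + 1) := by
    intro k l t ht
    have hint : ∀ k, IntervalIntegrable (fun s => ‖B s - B' k s‖) volume 0 T := fun k =>
      (hBi.sub ((hB'c k).intervalIntegrable 0 T)).norm
    calc _ ≤ ∫ s in (0 : ℝ)..t, ‖B' k s - B' l s‖ :=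
          norm_solution_sub_le (hB'c l) (hB'c k) (fun s => (hle (hB'm l s)).1) (hV0 l) (hV0 k)
            (hVd l) (hVd k) ht.1
      _ ≤ ∫ s in (0 : ℝ)..T, ‖B' k s - B' l s‖ :=
          intervalIntegral.integral_mono_interval le_rfl ht.1 ht.2
            (Eventually.of_forall fun s => norm_nonneg _)
            (((hB'c k).sub (hB'c l)).norm.intervalIntegrable 0 T)
      _ ≤ ∫ s in (0 : ℝ)..T, (‖B s - B' k s‖ + ‖B s - B' l s‖) := by
          refine intervalIntegral.integral_mono_on hT
            (((hB'c k).sub (hB'c l)).norm.intervalIntegrable 0 T) ((hint k).add (hint l))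
            fun s _ => ?_
          rw [← norm_neg (B s - B' k s)]
          refine le_trans (le_of_eq ?_) (norm_add_le _ _)
          congr 1
          abel
      _ ≤ _ := by
          rw [intervalIntegral.integral_add (hint k) (hint l)]
          exact add_le_add (hB'i k) (hB'i l)
  -- The limits are taken among all matrices, so closedness in `SU(n)` is transferred there.
  have hcl' : IsClosed (Subtype.val '' (expSubgroup 𝔩 : Set (Matrix.specialUnitaryGroup (Fin n) ℂ))) :=
    isClosed_specialUnitaryGroup.isClosedEmbedding_subtypeVal.isClosedMap _ hcl
  have hlim : ∀ t ∈ Set.Icc 0 T, ∃ w ∈ expSubgroup 𝔩,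
      Tendsto (fun k => (V k t : Matrix (Fin n) (Fin n) ℂ)) atTop
        (𝓝 (w : Matrix (Fin n) (Fin n) ℂ)) := by
    intro t ht
    have hcau : CauchySeq fun k => (V k t : Matrix (Fin n) (Fin n) ℂ) := by
      refine cauchySeq_of_le_tendsto_0 (fun N : ℕ => 2 * (1 / ((N : ℝ) + 1))) ?_ ?_
      · intro k l N hk hl
        rw [dist_eq_norm, two_mul]
        refine (hdist k l t ht).trans (add_le_add ?_ ?_) <;> gcongr
      · simpa using (tendsto_one_div_add_atTop_nhds_zero_nat (𝕜 := ℝ)).const_mul 2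
    obtain ⟨w, hw⟩ := cauchySeq_tendsto_of_complete hcau
    obtain ⟨w', hw', rfl⟩ := hcl'.mem_of_tendsto hw
      (Eventually.of_forall fun k => ⟨V k t, hVm k t, rfl⟩)
    exact ⟨w', hw', hw⟩
  choose! w hwm hw using hlim
  have hle' : ∀ k : ℕ, ∀ t ∈ Set.Icc 0 T,
      ‖(V k t : Matrix (Fin n) (Fin n) ℂ) - w t‖ ≤ 1 / ((k : ℝ) + 1) := by
    intro k t ht
    refine le_of_tendsto_of_tendsto (tendsto_const_nhds.sub (hw t ht)).norm
      (tendsto_const_nhds.add tendsto_one_div_add_atTop_nhds_zero_nat |>.trans_eq ?_)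
      (Eventually.of_forall fun l => hdist k l t ht)
    rw [add_zero]
  have hwc : ContinuousOn (fun t => (w t : Matrix (Fin n) (Fin n) ℂ)) (Set.Icc 0 T) := by
    have hu : TendstoUniformlyOn (fun k t => (V k t : Matrix (Fin n) (Fin n) ℂ))
        (fun t => (w t : Matrix (Fin n) (Fin n) ℂ)) atTop (Set.Icc 0 T) := by
      refine Metric.tendstoUniformlyOn_iff.mpr fun ε hε => ?_
      filter_upwards [(tendsto_one_div_add_atTop_nhds_zero_nat (𝕜 := ℝ)).eventually
        (gt_mem_nhds hε)] with k hk t ht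
      rw [dist_comm, dist_eq_norm]
      exact (hle' k t ht).trans_lt hk
    exact hu.continuousOn (Eventually.of_forall fun k t _ =>
      (hVd k t).continuousAt.continuousWithinAt).frequently
  -- Outside `[0, T]` the limit is extended by its values at the end points, which makes it
  -- continuous on the whole line.
  refine ⟨fun t => w (Set.projIcc 0 T hT t), B', V, fun t => hwm _ (Subtype.coe_prop _), ?_,
    fun k => ⟨hB'c k, hV0 k, hVd k, hB'i k, fun t ht => ?_⟩⟩
  · exact (continuousOn_iff_continuous_domRestrict.mp hwc).comp continuous_projIcc
  · simp only [Set.projIcc_of_mem hT ht]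
    exact hle' k t ht

theorem intervalIntegral_matrix_apply {F : ℝ → Matrix (Fin n) (Fin n) ℂ} {a b : ℝ}
    (hF : IntervalIntegrable F volume a b) (i j : Fin n) :
    (∫ s in a..b, F s) i j = ∫ s in a..b, F s i j :=
  ((LinearMap.toContinuousLinearMap (Matrix.entryLinearMap ℝ ℂ i j)).intervalIntegral_comp_comm
    hF).symm

/-! ### The evolution in the frame moving with the controls. -/

/-- The part of `-i H(t)` that comes from the controls. -/
noncomputable def ctrlPart (S : ControlSystem n m) (f : Fin m → ℝ → ℝ) (t : ℝ) :
    Matrix (Fin n) (Fin n) ℂ :=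
  -∑ j, f j t • (Complex.I • S.ctrl j)

theorem ctrlPart_mem (S : ControlSystem n m) (f : Fin m → ℝ → ℝ) (t : ℝ) :
    S.ctrlPart f t ∈ S.ctrlAlgebra :=
  neg_mem (sum_mem fun j _ => S.ctrlAlgebra.smul_mem _
    (LieSubalgebra.subset_lieSpan ⟨j, rfl⟩))

theorem intervalIntegrable_ctrlPart (S : ControlSystem n m) {f : Fin m → ℝ → ℝ} {a b : ℝ}
    (hf : ∀ j, IntervalIntegrable (f j) volume a b) :
    IntervalIntegrable (S.ctrlPart f) volume a b := by
  have : S.ctrlPart f = -∑ j, fun t => f j t • (Complex.I • S.ctrl j) := by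
    ext t : 1
    simp [ctrlPart]
  rw [this]
  have hj : ∀ j, IntervalIntegrable (fun t => f j t • (Complex.I • S.ctrl j)) volume a b :=
    fun j => ⟨Integrable.smul_const (hf j).1 _, Integrable.smul_const (hf j).2 _⟩
  exact (IntervalIntegrable.sum _ fun j _ => hj j).neg

theorem neg_I_smul_hamiltonian_mul (S : ControlSystem n m) (f : Fin m → ℝ → ℝ) (t : ℝ)
    (X : Matrix (Fin n) (Fin n) ℂ) :
    (-Complex.I) • (S.hamiltonian f t * X) =
      (-(Complex.I • S.drift) + S.ctrlPart f t) * X := by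
  rw [← smul_mul_assoc, hamiltonian, ctrlPart, smul_add, Finset.smul_sum, ← Finset.sum_neg_distrib,
    neg_smul]
  congr 2
  refine Finset.sum_congr rfl fun j _ => ?_
  rw [neg_smul, smul_comm]

/-- The integrated Schrödinger equation as an equation between matrices. -/
theorem IsEvolution.eq_one_add_integral {S : ControlSystem n m} {T : ℝ} {f : Fin m → ℝ → ℝ}
    {U : ℝ → Matrix (Fin n) (Fin n) ℂ} (h : S.IsEvolution T f U) (hT : 0 ≤ T)
    {t : ℝ} (ht : t ∈ Set.Icc 0 T) :
    IntervalIntegrable (fun s => (-(Complex.I • S.drift) + S.ctrlPart f s) * U s) volume 0 t ∧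
    U t = 1 + ∫ s in (0 : ℝ)..t, (-(Complex.I • S.drift) + S.ctrlPart f s) * U s := by
  have hint : IntervalIntegrable (fun s => (-(Complex.I • S.drift) + S.ctrlPart f s) * U s)
      volume 0 T := by
    refine IntervalIntegrable.mul_continuousOn
      (intervalIntegrable_const.add (S.intervalIntegrable_ctrlPart h.integrable)) ?_
    rw [Set.uIcc_of_le hT]
    exact h.continuousOn
  have hint' := hint.mono_set (Set.uIcc_subset_uIcc_left (Set.mem_uIcc_of_le ht.1 ht.2))
  refine ⟨hint', ?_⟩
  ext i j
  rw [h.schroedinger t ht, Matrix.add_apply, intervalIntegral_matrix_apply hint']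
  simp only [neg_I_smul_hamiltonian_mul]

/-- The evolution in the frame that moves with the controls: `U = w Q`, where `w` takes values in
the control group and `Q` is a `C¹` curve in the dynamical group. -/
theorem IsEvolution.exists_eq_mul {S : ControlSystem n m}
    (hK : IsClosed (S.K : Set (Matrix.specialUnitaryGroup (Fin n) ℂ))) {T : ℝ} (hT : 0 ≤ T)
    {f : Fin m → ℝ → ℝ} {U : ℝ → Matrix (Fin n) (Fin n) ℂ} (h : S.IsEvolution T f U) :
    ∃ w Q : ℝ → Matrix.specialUnitaryGroup (Fin n) ℂ, (∀ t, w t ∈ S.K) ∧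
      Continuous (fun t => (w t : Matrix (Fin n) (Fin n) ℂ)) ∧ (∀ t, Q t ∈ S.G) ∧ Q 0 = 1 ∧
      (∀ t, HasDerivAt (fun t => (Q t : Matrix (Fin n) (Fin n) ℂ))
        ((w t : Matrix (Fin n) (Fin n) ℂ)ᴴ * (-(Complex.I • S.drift)) * w t * Q t) t) ∧
      U T = w T * Q T := by
  obtain ⟨w, B', V, hwK, hwc, hV⟩ := exists_limit_solution
    ((ctrlAlgebra_le_dynAlgebra S).trans (dynAlgebra_le_suAlgebra S)) hK (S.ctrlPart_mem f) hT
    (S.intervalIntegrable_ctrlPart h.integrable)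
  set N : Matrix (Fin n) (Fin n) ℂ := -(Complex.I • S.drift) with hN
  have hNmem : N ∈ S.dynAlgebra := neg_mem (LieSubalgebra.subset_lieSpan (Set.mem_insert _ _))
  set A : ℝ → Matrix (Fin n) (Fin n) ℂ := fun t => (w t : Matrix (Fin n) (Fin n) ℂ)ᴴ * N * w t
    with hA
  have hAc : Continuous A := by
    have : Continuous fun t => (w t : Matrix (Fin n) (Fin n) ℂ)ᴴ := hwc.star
    fun_prop
  have hAN : ∀ t, ‖A t‖ ≤ ‖N‖ := fun t => by
    calc _ ≤ 1 * ‖N‖ * 1 := by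
          refine (norm_mul_le _ _).trans ?_
          gcongr
          · refine (norm_mul_le _ _).trans ?_
            gcongr
            exact norm_conjTranspose_coe_le_one _
          · exact norm_coe_le_one _
      _ = _ := by ring
  obtain ⟨Q, hQG, hQ0, hQ⟩ := exists_solution_expSubgroup (dynAlgebra_le_suAlgebra S) hAc
    (fun t => conj_mem (ctrlAlgebra_le_dynAlgebra S) (hwK t) hNmem) hAN
  refine ⟨w, Q, hwK, hwc, hQG, hQ0, hQ, ?_⟩
  have hQc : Continuous fun t => (Q t : Matrix (Fin n) (Fin n) ℂ) :=
    continuous_iff_continuousAt.mpr fun t => (hQ t).continuousAt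
  obtain ⟨M, hM⟩ := isCompact_Icc.exists_bound_of_continuousOn h.continuousOn
  have hM0 : 0 ≤ M := (norm_nonneg _).trans (hM 0 ⟨le_rfl, hT⟩)
  -- A globally continuous extension of `U`, as needed for Grönwall's inequality.
  set Ue : ℝ → Matrix (Fin n) (Fin n) ℂ := fun t => U (Set.projIcc 0 T hT t) with hUe
  have hUec : Continuous Ue :=
    (continuousOn_iff_continuous_domRestrict.mp h.continuousOn).comp continuous_projIcc
  have hUeq : ∀ t ∈ Set.Icc 0 T, Ue t = U t := fun t ht => by
    simp only [hUe, Set.projIcc_of_mem hT ht]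
  have hci := S.intervalIntegrable_ctrlPart h.integrable
  -- `w` is not known to be differentiable, so `U` is compared with `V k * Q`, where the product
  -- rule is available.
  have hbound : ∀ k : ℕ, ‖U T - V k T * Q T‖ ≤ (M + 2 * ‖N‖ * T) * (1 / ((k : ℝ) + 1)) *
      Real.exp (‖N‖ * T + ((∫ s in (0 : ℝ)..T, ‖S.ctrlPart f s‖) + 1)) := by
    intro k
    obtain ⟨hBc, hV0, hVd, hBi, hVw⟩ := hV k
    set δ : ℝ := 1 / ((k : ℝ) + 1) with hδ
    have hδ0 : 0 ≤ δ := by positivity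
    have hδ1 : δ ≤ 1 := by
      rw [hδ, div_le_one (by positivity)]
      linarith [(Nat.cast_nonneg k : (0 : ℝ) ≤ k)]
    have hVc : Continuous fun t => (V k t : Matrix (Fin n) (Fin n) ℂ) :=
      continuous_iff_continuousAt.mpr fun t => (hVd t).continuousAt
    set D : ℝ → Matrix (Fin n) (Fin n) ℂ := fun t => Ue t - V k t * Q t with hD
    have hDc : Continuous D := hUec.sub (hVc.mul hQc)
    have hdiff : ∀ t ∈ Set.Icc 0 T, ‖D t‖ ≤ (M + 2 * ‖N‖ * T) * δ +
        ∫ s in (0 : ℝ)..t, (‖N‖ + ‖B' k s‖) * ‖D s‖ := by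
      intro t ht
      obtain ⟨hUi, hUt⟩ := h.eq_one_add_integral hT ht
      have hpc : Continuous fun s => B' k s * V k s * Q s + V k s * (A s * Q s) := by fun_prop
      have hp := intervalIntegral.integral_eq_sub_of_hasDerivAt
        (fun s _ => (hVd s).mul (hQ s)) (hpc.intervalIntegrable 0 t)
      have hsub : Set.uIcc 0 t ⊆ Set.uIcc 0 T :=
        Set.uIcc_subset_uIcc_left (Set.mem_uIcc_of_le ht.1 ht.2)
      have hBd : IntervalIntegrable (fun s => ‖S.ctrlPart f s - B' k s‖) volume 0 T :=
        (hci.sub (hBc.intervalIntegrable 0 T)).norm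
      have hbc : Continuous fun s => (‖N‖ + ‖B' k s‖) * ‖D s‖ := by fun_prop
      have hg1 : IntervalIntegrable (fun s => M * ‖S.ctrlPart f s - B' k s‖) volume 0 t :=
        (hBd.mono_set hsub).const_mul M
      have hg2 : IntervalIntegrable (fun _ : ℝ => 2 * ‖N‖ * δ) volume 0 t :=
        intervalIntegrable_const
      have heq : D t = ∫ s in (0 : ℝ)..t, ((N + S.ctrlPart f s) * U s -
          (B' k s * V k s * Q s + V k s * (A s * Q s))) := by
        rw [intervalIntegral.integral_sub hUi (hpc.intervalIntegrable 0 t), hp]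
        simp only [hD, hUeq t ht, Pi.mul_apply, hV0, hQ0]
        rw [hUt, OneMemClass.coe_one, mul_one]
        abel
      have hpt : ∀ s ∈ Set.Icc 0 t, ‖(N + S.ctrlPart f s) * U s -
          (B' k s * V k s * Q s + V k s * (A s * Q s))‖ ≤
          M * ‖S.ctrlPart f s - B' k s‖ + 2 * ‖N‖ * δ + (‖N‖ + ‖B' k s‖) * ‖D s‖ := by
        intro s hs
        have hs' : s ∈ Set.Icc 0 T := ⟨hs.1, hs.2.trans ht.2⟩
        have hwA : (w s : Matrix (Fin n) (Fin n) ℂ) * A s = N * w s := by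
          rw [hA, ← mul_assoc, ← mul_assoc, mul_star_self_coe, one_mul]
        -- The three terms are the error of the approximated controls, the error of using `w`
        -- instead of `V k` in the equation for `Q`, which enters through `w A = N w`, and the
        -- Grönwall term.
        have hsplit : (N + S.ctrlPart f s) * U s -
            (B' k s * V k s * Q s + V k s * (A s * Q s)) =
            (S.ctrlPart f s - B' k s) * U s +
            (N * ((V k s : Matrix (Fin n) (Fin n) ℂ) - w s) -
              ((V k s : Matrix (Fin n) (Fin n) ℂ) - w s) * A s) * Q s +
            (N + B' k s) * D s := by
          rw [sub_mul (V k s : Matrix (Fin n) (Fin n) ℂ), hwA]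
          simp only [hD, hUeq s hs']
          noncomm_ring
        rw [hsplit]
        refine (norm_add₃_le).trans (add_le_add (add_le_add ?_ ?_) ?_)
        · refine (norm_mul_le _ _).trans ?_
          rw [mul_comm]
          gcongr
          exact hM s hs'
        · calc _ ≤ (‖N‖ * δ + δ * ‖N‖) * 1 := by
                refine (norm_mul_le _ _).trans ?_
                gcongr
                · refine (norm_sub_le _ _).trans (add_le_add ?_ ?_)
                  · refine (norm_mul_le _ _).trans ?_
                    gcongr
                    exact hVw s hs'
                  · refine (norm_mul_le _ _).trans ?_
                    gcongr
                    · exact hVw s hs'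
                    · exact hAN s
                · exact norm_coe_le_one _
            _ = _ := by ring
        · refine (norm_mul_le _ _).trans ?_
          gcongr
          exact norm_add_le _ _
      calc ‖D t‖ ≤ ∫ s in (0 : ℝ)..t, ‖(N + S.ctrlPart f s) * U s -
          (B' k s * V k s * Q s + V k s * (A s * Q s))‖ := by
            rw [heq]; exact intervalIntegral.norm_integral_le_integral_norm ht.1
        _ ≤ ∫ s in (0 : ℝ)..t, (M * ‖S.ctrlPart f s - B' k s‖ + 2 * ‖N‖ * δ +
              (‖N‖ + ‖B' k s‖) * ‖D s‖) :=
            intervalIntegral.integral_mono_on ht.1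
              (hUi.sub (hpc.intervalIntegrable 0 t)).norm
              ((hg1.add hg2).add (hbc.intervalIntegrable 0 t)) hpt
        _ = M * (∫ s in (0 : ℝ)..t, ‖S.ctrlPart f s - B' k s‖) + 2 * ‖N‖ * δ * t +
              ∫ s in (0 : ℝ)..t, (‖N‖ + ‖B' k s‖) * ‖D s‖ := by
            rw [intervalIntegral.integral_add (hg1.add hg2) (hbc.intervalIntegrable 0 t),
              intervalIntegral.integral_add hg1 hg2, intervalIntegral.integral_const_mul,
              intervalIntegral.integral_const, smul_eq_mul, sub_zero, mul_comm t]
        _ ≤ M * δ + 2 * ‖N‖ * δ * T + ∫ s in (0 : ℝ)..t, (‖N‖ + ‖B' k s‖) * ‖D s‖ := by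
            gcongr
            · refine le_trans ?_ hBi
              exact intervalIntegral.integral_mono_interval le_rfl ht.1 ht.2
                (Eventually.of_forall fun s => norm_nonneg _) hBd
            · exact ht.2
        _ = _ := by ring
    have hgron := le_mul_exp_integral_of_le_add_integral (φ := fun t => ‖D t‖)
      (b := fun s => ‖N‖ + ‖B' k s‖) hT hDc.norm (continuous_const.add hBc.norm)
      (fun s => by positivity) hdiff
    -- A bound on the Grönwall exponent that does not depend on `k`.
    have hexp : ∫ s in (0 : ℝ)..T, (‖N‖ + ‖B' k s‖) ≤
        ‖N‖ * T + ((∫ s in (0 : ℝ)..T, ‖S.ctrlPart f s‖) + 1) := by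
      rw [intervalIntegral.integral_add intervalIntegrable_const
        (hBc.norm.intervalIntegrable 0 T), intervalIntegral.integral_const, smul_eq_mul, sub_zero,
        mul_comm T]
      gcongr
      calc ∫ s in (0 : ℝ)..T, ‖B' k s‖
          ≤ ∫ s in (0 : ℝ)..T, (‖S.ctrlPart f s‖ + ‖S.ctrlPart f s - B' k s‖) := by
            refine intervalIntegral.integral_mono_on hT (hBc.norm.intervalIntegrable 0 T)
              (hci.norm.add (hci.sub (hBc.intervalIntegrable 0 T)).norm) fun s _ => ?_
            have := norm_sub_le (S.ctrlPart f s) (S.ctrlPart f s - B' k s)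
            rwa [sub_sub_cancel] at this
        _ ≤ _ := by
            rw [intervalIntegral.integral_add hci.norm
              (hci.sub (hBc.intervalIntegrable 0 T)).norm]
            gcongr
            exact hBi.trans hδ1
    have hUT : D T = U T - V k T * Q T := by
      simp only [hD, hUeq T ⟨hT, le_rfl⟩]
    rw [← hUT]
    refine hgron.trans ?_
    gcongr
  have hVT : Tendsto (fun k => (V k T : Matrix (Fin n) (Fin n) ℂ)) atTop (𝓝 (w T)) := by
    rw [tendsto_iff_norm_sub_tendsto_zero]
    exact squeeze_zero (fun _ => norm_nonneg _) (fun k => (hV k).2.2.2.2 T ⟨hT, le_rfl⟩)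
      tendsto_one_div_add_atTop_nhds_zero_nat
  have hlim1 : Tendsto (fun k => ‖U T - V k T * Q T‖) atTop (𝓝 ‖U T - w T * Q T‖) :=
    (tendsto_const_nhds.sub (hVT.mul_const _)).norm
  have hlim2 := squeeze_zero (fun _ => norm_nonneg _) hbound (by
    simpa using ((tendsto_one_div_add_atTop_nhds_zero_nat (𝕜 := ℝ)).const_mul
      (M + 2 * ‖N‖ * T)).mul_const
        (Real.exp (‖N‖ * T + ((∫ s in (0 : ℝ)..T, ‖S.ctrlPart f s‖) + 1))))
  exact sub_eq_zero.mp (norm_eq_zero.mp (tendsto_nhds_unique hlim1 hlim2))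

/-! ### Lengths of the projected curves and the speed limit. -/

/-- For skew-Hermitian `X`, `-Tr(X²) = Tr(Xᴴ X)` is a sum of squared moduli. -/
theorem form_self_nonneg {X : Matrix (Fin n) (Fin n) ℂ} (hX : Xᴴ = -X) : 0 ≤ form n X X := by
  have h : ((X * X).trace).re = -((Xᴴ * X).trace).re := by simp [hX]
  have h2 : 0 ≤ ((Xᴴ * X).trace).re := by
    simp only [Matrix.trace, Matrix.diag_apply, Matrix.mul_apply, Complex.re_sum]
    refine Finset.sum_nonneg fun i _ => Finset.sum_nonneg fun j _ => ?_
    simpa [Complex.normSq_apply] using Complex.normSq_nonneg (X j i)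
  rw [form_apply, h]
  nlinarith [mul_nonneg (Nat.cast_nonneg n : (0 : ℝ) ≤ n) h2]

/-- The horizontal part of a matrix is not longer than the matrix. -/
theorem form_horizontalPart_le (S : ControlSystem n m) (X : Matrix (Fin n) (Fin n) ℂ) :
    form n (S.horizontalPart X) (S.horizontalPart X) ≤ form n X X := by
  set Y := S.horizontalPart X
  have hY : Y ∈ (form n).orthogonal S.ctrlAlgebra.toSubmodule :=
    Submodule.projection_apply_mem S.isCompl_ctrlAlgebra X
  have hZ : X - Y ∈ S.ctrlAlgebra.toSubmodule :=
    Submodule.sub_projection_mem S.isCompl_ctrlAlgebra X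
  have h1 : form n (X - Y) Y = 0 := hY _ hZ
  have h2 : form n Y (X - Y) = 0 := form_isRefl n _ _ h1
  -- Pythagoras: only the component in `𝔨` has to have nonnegative square, so `X` itself may be
  -- arbitrary.
  have h3 := form_self_nonneg (S.conjTranspose_of_mem_ctrlAlgebra hZ)
  have h4 : form n X X = form n (Y + (X - Y)) (Y + (X - Y)) := by rw [add_sub_cancel]
  rw [h4]
  simp only [map_add, LinearMap.add_apply]
  linarith

theorem form_conj (g : Matrix.specialUnitaryGroup (Fin n) ℂ) (X : Matrix (Fin n) (Fin n) ℂ) :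
    form n ((g : Matrix (Fin n) (Fin n) ℂ)ᴴ * X * g) ((g : Matrix (Fin n) (Fin n) ℂ)ᴴ * X * g) =
      form n X X := by
  have h : (g : Matrix (Fin n) (Fin n) ℂ)ᴴ * X * g * ((g : Matrix (Fin n) (Fin n) ℂ)ᴴ * X * g) =
      (g : Matrix (Fin n) (Fin n) ℂ)ᴴ * (X * X) * g := by
    calc _ = (g : Matrix (Fin n) (Fin n) ℂ)ᴴ * X *
        ((g : Matrix (Fin n) (Fin n) ℂ) * (g : Matrix (Fin n) (Fin n) ℂ)ᴴ) * X * g := by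
          noncomm_ring
      _ = _ := by rw [mul_star_self_coe]; noncomm_ring
  rw [form_apply, h, Matrix.trace_mul_cycle, mul_star_self_coe, one_mul, form_apply]

theorem form_neg_I_smul (X : Matrix (Fin n) (Fin n) ℂ) :
    form n (-(Complex.I • X)) (-(Complex.I • X)) = 2 * (n : ℝ) * ((X * X).trace).re := by
  simp [form_apply, smul_smul]

theorem hasDerivAt_matrix_apply {F : ℝ → Matrix (Fin n) (Fin n) ℂ}
    {F' : Matrix (Fin n) (Fin n) ℂ} {t : ℝ} (h : HasDerivAt F F' t) (i j : Fin n) :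
    HasDerivAt (fun s => F s i j) (F' i j) t :=
  (LinearMap.toContinuousLinearMap (Matrix.entryLinearMap ℝ ℂ i j)).hasFDerivAt.comp_hasDerivAt t h

/-- The right velocity of a curve that solves `γ' = A γ`. -/
theorem rightVelocity_of_hasDerivAt (S : ControlSystem n m) {γ : ℝ → S.G}
    {A : ℝ → Matrix (Fin n) (Fin n) ℂ}
    (h : ∀ t, HasDerivAt (fun t => S.mat (γ t)) (A t * S.mat (γ t)) t) {t : ℝ}
    (ht : t ∈ Set.Icc (0 : ℝ) 1) : S.rightVelocity γ t = A t := by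
  have hv : S.velocity γ t = A t * S.mat (γ t) := by
    ext i j
    exact ((hasDerivAt_matrix_apply (h t) i j).hasDerivWithinAt).derivWithin
      (uniqueDiffOn_Icc zero_lt_one t ht)
  have hinv : S.mat (γ t)⁻¹ = (S.mat (γ t))ᴴ := coe_inv_eq (γ t).1
  rw [rightVelocity, hv, hinv, mul_assoc, mul_star_self_coe, mul_one]

theorem isCurve_of_hasDerivAt (S : ControlSystem n m) {γ : ℝ → S.G}
    {A : ℝ → Matrix (Fin n) (Fin n) ℂ} (hA : Continuous A) (hA' : ∀ t, A t ∈ S.dynAlgebra)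
    (h : ∀ t, HasDerivAt (fun t => S.mat (γ t)) (A t * S.mat (γ t)) t) : S.IsCurve γ where
  contDiffOn i j := by
    have hc : Continuous fun t => S.mat (γ t) :=
      continuous_iff_continuousAt.mpr fun t => (h t).continuousAt
    have hd := fun t => hasDerivAt_matrix_apply (h t) i j
    refine (contDiff_one_iff_deriv.mpr ⟨fun t => (hd t).differentiableAt, ?_⟩).contDiffOn
    rw [deriv_eq hd]
    exact (hA.mul hc).matrix_elem i j
  tangent t ht := by rw [S.rightVelocity_of_hasDerivAt h ht]; exact hA' t

/-- The right velocity has constant square `c` over a time interval of length one, and the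
horizontal projection does not increase it. -/
theorem projLength_le (S : ControlSystem n m) {γ : ℝ → S.G}
    {A : ℝ → Matrix (Fin n) (Fin n) ℂ}
    (h : ∀ t, HasDerivAt (fun t => S.mat (γ t)) (A t * S.mat (γ t)) t) {c : ℝ}
    (hc : ∀ t, form n (A t) (A t) = c) :
    S.projLength γ ≤ ENNReal.ofReal (Real.sqrt c) := by
  calc S.projLength γ ≤ ∫⁻ _ in Set.Icc (0 : ℝ) 1, ENNReal.ofReal (Real.sqrt c) := by
        refine setLIntegral_mono measurable_const fun t ht => ?_
        rw [S.rightVelocity_of_hasDerivAt h ht, ← hc t]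
        exact ENNReal.ofReal_le_ofReal (Real.sqrt_le_sqrt
          (S.form_horizontalPart_le _))
    _ = _ := by simp

/-- The elements of `G` that are reachable within the time `T` move the points of `G/K` by at most
`T` times the norm of the drift. -/
theorem cosetDist_proj_le (S : ControlSystem n m)
    (hK : IsClosed (S.K : Set (Matrix.specialUnitaryGroup (Fin n) ℂ))) {T : ℝ} (a b : S.G)
    (h : S.ReachableWithin T (S.mat (b * a⁻¹))) :
    S.cosetDist (S.proj a) (S.proj b) ≤ ENNReal.ofReal
      (T * Real.sqrt (2 * (n : ℝ) * ((S.drift * S.drift).trace).re)) := by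
  obtain ⟨t, ⟨ht0, htT⟩, f, U, hU, hUt⟩ := h
  obtain ⟨w, Q, hwK, hwc, hQG, hQ0, hQ, hUwQ⟩ := hU.exists_eq_mul hK ht0
  set N : Matrix (Fin n) (Fin n) ℂ := -(Complex.I • S.drift) with hN
  set A : ℝ → Matrix (Fin n) (Fin n) ℂ := fun s => (w s : Matrix (Fin n) (Fin n) ℂ)ᴴ * N * w s
    with hA
  have hAm : ∀ s, A s ∈ S.dynAlgebra := fun s => conj_mem S.ctrlAlgebra_le_dynAlgebra (hwK s)
    (neg_mem (LieSubalgebra.subset_lieSpan (Set.mem_insert _ _)))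
  have hAc : Continuous A := by
    have : Continuous fun t => (w t : Matrix (Fin n) (Fin n) ℂ)ᴴ := hwc.star
    fun_prop
  -- `Q` on `[0, t]`, rescaled to the unit interval and right-translated so as to start at `a`.
  -- Rescaling multiplies the velocity by `t`.
  set γ : ℝ → S.G := fun s => ⟨Q (t * s), hQG _⟩ * a with hγ
  have hmat : ∀ s, S.mat (γ s) = (Q (t * s) : Matrix (Fin n) (Fin n) ℂ) * S.mat a := fun s => rfl
  have hd : ∀ s, HasDerivAt (fun s => S.mat (γ s)) ((t • A (t * s)) * S.mat (γ s)) s := fun s => by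
    have h1 : HasDerivAt (fun s => t * s) t s := by simpa using (hasDerivAt_id s).const_mul t
    have h2 := ((hQ (t * s)).scomp s h1).mul_const (S.mat a)
    simp only [hmat]
    refine h2.congr_deriv ?_
    rw [smul_mul_assoc, smul_mul_assoc, mul_assoc]
  have hm : ∀ s, t • A (t * s) ∈ S.dynAlgebra := fun s => S.dynAlgebra.smul_mem _ (hAm _)
  have hform : ∀ s, form n (t • A (t * s)) (t • A (t * s)) =
      t ^ 2 * (2 * (n : ℝ) * ((S.drift * S.drift).trace).re) := fun s => by
    rw [← form_neg_I_smul S.drift, ← hN, ← form_conj (w (t * s)) N]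
    simp only [map_smul, LinearMap.smul_apply, smul_eq_mul]
    rw [← mul_assoc, ← sq]
  have hγ0 : S.proj (γ 0) = S.proj a := by
    have : γ 0 = a := by
      simp only [hγ, mul_zero, hQ0]
      exact one_mul a
    rw [this]
  have hγ1 : S.proj (γ 1) = S.proj b := by
    refine Quotient.sound (QuotientGroup.rightRel_apply.mpr ?_)
    -- From `b a⁻¹ = w(t) Q(t)` it follows that `b = w(t) γ(1)`, so the end point lies in the coset
    -- of `b`.
    have hw : (b * (γ 1)⁻¹ : S.G).1 = w t := by
      have h1 : (b * a⁻¹ : S.G).1 = w t * Q t := Subtype.ext (hUt.symm.trans hUwQ)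
      have h2 : (b * (γ 1)⁻¹ : S.G).1 = (b * a⁻¹ : S.G).1 * (Q t)⁻¹ := by
        simp [hγ, mul_assoc]
      rw [h2, h1, mul_inv_cancel_right]
    rw [Subgroup.mem_subgroupOf, hw]
    exact hwK t
  calc S.cosetDist (S.proj a) (S.proj b) ≤ S.projLength γ :=
        iInf_le_of_le γ (iInf_le_of_le (S.isCurve_of_hasDerivAt
          ((hAc.comp (continuous_const.mul continuous_id)).const_smul t) hm hd)
          (iInf_le_of_le hγ0 (iInf_le_of_le hγ1 le_rfl)))
    _ ≤ ENNReal.ofReal (t * Real.sqrt (2 * (n : ℝ) * ((S.drift * S.drift).trace).re)) := by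
        refine (S.projLength_le hd hform).trans_eq ?_
        rw [Real.sqrt_mul (sq_nonneg t), Real.sqrt_sq ht0]
    _ ≤ _ := ENNReal.ofReal_le_ofReal (by gcongr)

end ControlSystem

theorem theorem1 {n m : ℕ} (S : ControlSystem n m)
    (hK : IsClosed (S.K : Set (Matrix.specialUnitaryGroup (Fin n) ℂ))) :
    S.cosetDiam / ENNReal.ofReal (Real.sqrt (2 * (n : ℝ) * ((S.drift * S.drift).trace).re))
      ≤ S.qslTime := by
  refine le_iInf fun T => le_iInf fun hT => le_iInf fun hreach => ?_
  -- The product form also covers a vanishing drift: it forces the diameter to be `0`, and `0 / 0 =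
  -- 0` in `ℝ≥0∞`.
  refine ENNReal.div_le_of_le_mul (iSup_le fun x => iSup_le fun y => ?_)
  rw [← ENNReal.ofReal_mul hT]
  induction x using Quotient.inductionOn with | _ a
  induction y using Quotient.inductionOn with | _ b
  exact S.cosetDist_proj_le hK a b (hreach _)
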